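/- **Theorem (probability of correct active user detection).** *System.* There are $M$ radio heads, $N_c$ subcarriers and $K$ users per subcarrier; the users are the pairs $(c,k)$, $1\le c\le N_c$, $1\le k\le K$. Let $\mathcal T$ be a non-empty set of users (the active ones), $s=\#\mathcal T$, let $P_u>0$ for $u\in\mathcal T$ and $P_{\min}=\min_{u\in\mathcal T}P_u$. The symbols $\mathbf x=(\mathbf x(u))_u$ satisfy $\mathbf x(u)\sim\mathcal{CN}(0,P_u)$ for $u\in\mathcal T$ and $\mathbf x(u)=0$ for $u\notin\mathcal T$. The channel from user $u=(c,k)$ to head $i$ is $H_{iu}=g_{iu}h_{iu}$, where the $h_{iu}$ are i.i.d. $\mathcal{CN}(0,1)$, and the random vectors $(g_{iu})_{1\le i\le M}$ are pairwise independent over $u$, with $0\le g_{iu}\le\bar g$, $\sum_i g_{iu}^2=M$ and $\mathbb E\,g_{iu}^2=1$. Let $\mathbf H_i$ be the $N_c\times KN_c$ matrix whose $(c',(c,k))$ entry is $H_{i,(c,k)}$ if $c'=c$ and $0$ otherwise. The compression matrices $\mathbf A_i\in\mathbb C^{R\times N_c}$ have entries $\mathbf A_i(r,c)=\sqrt{1/(MR)}\,e^{j\theta_{irc}}$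 with $\theta_{irc}$ i.i.d. uniform on $[0,2\pi)$, and the noises $\mathbf n_i\in\mathbb C^{N_c}$ have i.i.d. $\mathcal{CN}(0,1)$ entries (jointly over $i$). The families $(g_{iu})$, $(h_{iu})$, $(\theta_{irc})$, $(\mathbf n_i)$, $\mathbf x$ are mutually independent. Put $\mathbf z_i=\mathbf A_i(\mathbf H_i\mathbf x+\mathbf n_i)$, let $\mathbf z\in\mathbb C^{MR}$ be the vector obtained by stacking the $\mathbf z_i$, and let $\Theta\in\mathbb C^{MR\times KN_c}$ be the matrix obtained by stacking the $\mathbf A_i\mathbf H_i$. *Detection.* Given $\lambda$, let $\hat{\mathbf x}$ be a solution of $\min\|\hat{\mathbf x}\|_1$ subject to $\|\Theta\hat{\mathbf x}-\mathbf z\|\le\lambda$, and sort the users as $i_1,\dots,i_{KN_c}$ so that $|\hat{\mathbf x}(i_1)|\ge|\hat{\mathbf x}(i_2)|\ge\cdots$. The detected set is $\hat{\mathcal T}=\{i_1,\dots,i_k\}$, where $k\ge1$ is the first index for which $\|(\mathbf I-\Theta_{S}\Theta_{S}^{\dagger})\mathbf z\|\le\lambda$ with $S=\{i_1,\dots,i_k\}$,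 or $k=MR$. Here $\Theta_S$ consists of the columns of $\Theta$ indexed by $S$ and $\dagger$ is the Moore–Penrose pseudoinverse. The choice of the minimizer and the breaking of ties are arbitrary, and so is $\hat{\mathcal T}$ where the constraint is infeasible. *Claim.* Let $\mathcal E_{2s,\delta}$ be the event that $\Theta$ has the restricted isometry property of order $2s$ with constant $\delta$, i.e. $0\le\delta<1$ and $(1-\delta)\|v\|^2\le\|\Theta v\|^2\le(1+\delta)\|v\|^2$ for all $v\in\mathbb C^{KN_c}$ with at most $2s$ non-zero entries. If $\delta<\sqrt2-1$ and $\lambda\ge\sqrt{2N_c}$, then $$\Pr(\hat{\mathcal T}=\mathcal T)\ \ge\ \Pr(\mathcal E_{2s,\delta})\left(1-\exp(-c_1M)-s\left(1-\exp\left(-\frac{2(c_2\lambda)^2}{P_{\min}}\right)\right)\right),$$ where $$c_1=\frac{\lambda^2-N_c}{4N_c},\qquad c_2=\frac{4\sqrt{1+\delta}}{1-(1+\sqrt2)\delta}.$$ -/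

import Mathlib

open MeasureTheory ProbabilityTheory

noncomputable section

namespace CRAN

/-! ### Linear algebra and compressed sensing -/

section Deterministic

variable {κ ι : Type*} [Fintype κ] [Fintype ι]

/-- The Euclidean norm of a complex vector. -/
def l2norm (v : ι → ℂ) : ℝ := ‖(WithLp.toLp 2 v : EuclideanSpace ℂ ι)‖

/-- The `ℓ₁` norm of a complex vector. -/
def l1norm (v : ι → ℂ) : ℝ := ∑ i, ‖v i‖

/-- The number of non-zero entries of a vector. -/
def l0norm (v : ι → ℂ) : ℕ := (Function.support v).ncard

/-- The restricted isometry property of order `k` with constant `δ`. -/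
def RIP (Θ : Matrix κ ι ℂ) (k : ℕ) (δ : ℝ) : Prop :=
  0 ≤ δ ∧ δ < 1 ∧ ∀ v : ι → ℂ, l0norm v ≤ k →
    (1 - δ) * l2norm v ^ 2 ≤ l2norm (Θ.mulVec v) ^ 2 ∧
    l2norm (Θ.mulVec v) ^ 2 ≤ (1 + δ) * l2norm v ^ 2

/-- The four Penrose conditions: `B` is the Moore-Penrose pseudoinverse of `A`. -/
structure IsMoorePenrose (A : Matrix κ ι ℂ) (B : Matrix ι κ ℂ) : Prop where
  mul_mul_left : A * B * A = A
  mul_mul_right : B * A * B = B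
  herm_left : (A * B).conjTranspose = A * B
  herm_right : (B * A).conjTranspose = B * A

theorem IsMoorePenrose.unique {A : Matrix κ ι ℂ} {B C : Matrix ι κ ℂ}
    (hB : IsMoorePenrose A B) (hC : IsMoorePenrose A C) : B = C := by
  have h1 : A * B = A * C := by
    have e : A * C * (A * B) = A * B := by
      rw [← Matrix.mul_assoc, hC.mul_mul_left]
    have := congrArg Matrix.conjTranspose e
    rw [Matrix.conjTranspose_mul, hB.herm_left, hC.herm_left, ← Matrix.mul_assoc,
      hB.mul_mul_left] at this
    exact this.symm
  have h2 : B * A = C * A := by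
    have e : B * A * (C * A) = B * A := by
      rw [Matrix.mul_assoc, ← Matrix.mul_assoc A, hC.mul_mul_left]
    have := congrArg Matrix.conjTranspose e
    rw [Matrix.conjTranspose_mul, hB.herm_right, hC.herm_right, Matrix.mul_assoc,
      ← Matrix.mul_assoc A, hB.mul_mul_left] at this
    exact this.symm
  rw [← hB.mul_mul_right, Matrix.mul_assoc, h1, ← Matrix.mul_assoc, h2, hC.mul_mul_right]

open scoped ComplexOrder in
theorem exists_isMoorePenrose (A : Matrix κ ι ℂ) : ∃ B, IsMoorePenrose A B := by
  classical
  have hG : (A.conjTranspose * A).IsHermitian := Matrix.isHermitian_conjTranspose_mul_self A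
  obtain ⟨P, hP, hGP, hPG⟩ : ∃ P : Matrix ι ι ℂ, P.conjTranspose = P ∧
      (A.conjTranspose * A) * P = P * (A.conjTranspose * A) ∧
      ((A.conjTranspose * A) * P * (A.conjTranspose * A) = A.conjTranspose * A ∧
        P * (A.conjTranspose * A) * P = P) := by
    set U : Matrix ι ι ℂ := (hG.eigenvectorUnitary : Matrix ι ι ℂ) with hU
    set d : ι → ℂ := fun i => (hG.eigenvalues i : ℂ) with hd
    have hUU : U.conjTranspose * U = 1 := by
      have := Unitary.coe_star_mul_self hG.eigenvectorUnitary
      simpa [Matrix.star_eq_conjTranspose] using this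
    have hspec : A.conjTranspose * A = U * Matrix.diagonal d * U.conjTranspose := by
      have := hG.spectral_theorem
      rw [Unitary.conjStarAlgAut_apply] at this
      exact this
    have key : ∀ a b : ι → ℂ, (U * Matrix.diagonal a * U.conjTranspose) *
        (U * Matrix.diagonal b * U.conjTranspose) =
        U * Matrix.diagonal (fun i => a i * b i) * U.conjTranspose := by
      intro a b
      calc _ = U * Matrix.diagonal a * (U.conjTranspose * U) * Matrix.diagonal b *
            U.conjTranspose := by simp only [Matrix.mul_assoc]
        _ = _ := by rw [hUU, Matrix.mul_one, Matrix.mul_assoc U, Matrix.diagonal_mul_diagonal]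
    refine ⟨U * Matrix.diagonal (fun i => (d i)⁻¹) * U.conjTranspose, ?_, ?_, ?_, ?_⟩
    · rw [Matrix.conjTranspose_mul, Matrix.conjTranspose_mul, Matrix.diagonal_conjTranspose,
        Matrix.conjTranspose_conjTranspose, Matrix.mul_assoc]
      congr 3
      ext i
      simp [hd]
    · rw [hspec, key, key]
      simp only [mul_comm]
    · rw [hspec, key, key]
      congr 3
      ext i
      exact mul_inv_mul_cancel (d i)
    · rw [hspec, key, key]
      congr 3
      ext i
      by_cases h : d i = 0 <;> simp [h]
  refine ⟨P * A.conjTranspose, ?_, ?_, ?_, ?_⟩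
  · have hz : A * (1 - P * (A.conjTranspose * A)) = 0 := by
      rw [← Matrix.conjTranspose_mul_self_eq_zero, Matrix.conjTranspose_mul, Matrix.mul_assoc,
        ← Matrix.mul_assoc A.conjTranspose A, Matrix.mul_sub, Matrix.mul_one,
        ← Matrix.mul_assoc (A.conjTranspose * A) P, hPG.1, sub_self, Matrix.mul_zero]
    rw [Matrix.mul_sub, Matrix.mul_one, sub_eq_zero] at hz
    simpa only [Matrix.mul_assoc] using hz.symm
  · calc P * A.conjTranspose * A * (P * A.conjTranspose)
        = (P * (A.conjTranspose * A) * P) * A.conjTranspose := by simp only [Matrix.mul_assoc]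
      _ = _ := by rw [hPG.2]
  · simp only [Matrix.conjTranspose_mul, Matrix.conjTranspose_conjTranspose, hP, Matrix.mul_assoc]
  · calc (P * A.conjTranspose * A).conjTranspose = (A.conjTranspose * A) * P := by
          simp only [Matrix.conjTranspose_mul, Matrix.conjTranspose_conjTranspose, hP,
            Matrix.mul_assoc]
      _ = P * A.conjTranspose * A := by rw [hGP, Matrix.mul_assoc]

/-- The Moore-Penrose pseudoinverse. -/
def pinv (A : Matrix κ ι ℂ) : Matrix ι κ ℂ := Classical.choose (exists_isMoorePenrose A)

theorem isMoorePenrose_pinv (A : Matrix κ ι ℂ) : IsMoorePenrose A (pinv A) :=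
  Classical.choose_spec (exists_isMoorePenrose A)

/-- For full column rank the pseudoinverse is `(AᴴA)⁻¹Aᴴ`. -/
theorem pinv_eq [DecidableEq ι] (A : Matrix κ ι ℂ)
    (h : IsUnit (A.conjTranspose * A).det) :
    pinv A = (A.conjTranspose * A)⁻¹ * A.conjTranspose := by
  have e : (A.conjTranspose * A)⁻¹ * A.conjTranspose * A = 1 := by
    rw [Matrix.mul_assoc, Matrix.nonsing_inv_mul _ h]
  refine (isMoorePenrose_pinv A).unique ⟨?_, ?_, ?_, ?_⟩
  · rw [Matrix.mul_assoc, e, Matrix.mul_one]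
  · rw [e, Matrix.one_mul]
  · rw [Matrix.conjTranspose_mul, Matrix.conjTranspose_mul, Matrix.conjTranspose_conjTranspose,
      Matrix.conjTranspose_nonsing_inv, Matrix.conjTranspose_mul,
      Matrix.conjTranspose_conjTranspose, Matrix.mul_assoc]
  · rw [e, Matrix.conjTranspose_one]

/-- The columns of `Θ` with index in `S`. -/
def colSub (Θ : Matrix κ ι ℂ) (S : Finset ι) : Matrix κ {u // u ∈ S} ℂ :=
  Θ.submatrix id Subtype.val

/-- `‖(I - Θ_S Θ_S†) z‖`. -/
def residual [DecidableEq κ] (Θ : Matrix κ ι ℂ) (z : κ → ℂ) (S : Finset ι) : ℝ :=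
  l2norm ((1 - colSub Θ S * pinv (colSub Θ S)).mulVec z)

/-- The feasible set of the basis pursuit problem. -/
def bpFeasible (Θ : Matrix κ ι ℂ) (z : κ → ℂ) (lam : ℝ) : Set (ι → ℂ) :=
  {v | l2norm (Θ.mulVec v - z) ≤ lam}

/-- `xhat` solves the basis pursuit problem: minimise `‖v‖₁` subject to `‖Θ v - z‖ ≤ lam`. -/
def IsBPSolution (Θ : Matrix κ ι ℂ) (z : κ → ℂ) (lam : ℝ) (xhat : ι → ℂ) : Prop :=
  xhat ∈ bpFeasible Θ z lam ∧ ∀ v ∈ bpFeasible Θ z lam, l1norm xhat ≤ l1norm v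

/-- The set `{i₁, …, i_k}` of the first `k` indices of the ordering `σ`. -/
def firstIndices (σ : Fin (Fintype.card ι) ≃ ι) (k : ℕ) : Finset ι :=
  Finset.univ.filter fun u => ((σ.symm u : Fin (Fintype.card ι)) : ℕ) < k

/-- The stopping test of the greedy detection at the `k`-th iteration:
the residual is at most `lam`, or `k` equals the number of measurements. -/
def GreedyStop [DecidableEq κ] (Θ : Matrix κ ι ℂ) (z : κ → ℂ) (lam : ℝ)
    (σ : Fin (Fintype.card ι) ≃ ι) (k : ℕ) : Prop :=
  residual Θ z (firstIndices σ k) ≤ lam ∨ k = Fintype.card κ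

/-- `S` is a possible output of active user detection: for some basis pursuit solution `xhat`
and some ordering `σ` of the indices by decreasing `|xhat|`, `S = {i₁, …, i_k}`, where `k ≥ 1` is
the first iteration at which the stopping test succeeds. -/
def IsDetectedSet [DecidableEq κ] (Θ : Matrix κ ι ℂ) (z : κ → ℂ) (lam : ℝ)
    (S : Finset ι) : Prop :=
  ∃ xhat : ι → ℂ, IsBPSolution Θ z lam xhat ∧
    ∃ σ : Fin (Fintype.card ι) ≃ ι, Antitone (fun k => ‖xhat (σ k)‖) ∧
      ∃ k : ℕ, 1 ≤ k ∧ k ≤ Fintype.card ι ∧ GreedyStop Θ z lam σ k ∧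
        (∀ j : ℕ, 1 ≤ j → j < k → ¬ GreedyStop Θ z lam σ j) ∧
        S = firstIndices σ k

end Deterministic

/-! ### The uplink system -/

/-- The law `𝒞𝒩(0, p)`: independent real and imaginary parts, each of law `𝒩(0, p/2)`. -/
def complexGaussian (p : NNReal) : Measure ℂ :=
  ((gaussianReal 0 (p / 2)).prod (gaussianReal 0 (p / 2))).map
    (fun q : ℝ × ℝ => (q.1 : ℂ) + (q.2 : ℂ) * Complex.I)

/-- The users: the pair `(c, k)` is the `k`-th user on the `c`-th subcarrier. -/
abbrev UE (K Nc : ℕ) : Type := Fin Nc × Fin K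

section System

variable {M K Nc R : ℕ}

/-- The channel coefficients `g h`, small scale times large scale fading. -/
def channel (g : Fin M → UE K Nc → ℝ) (h : Fin M → UE K Nc → ℂ) : Fin M → UE K Nc → ℂ :=
  fun i u => (g i u : ℂ) * h i u

/-- The aggregate channel matrix `H_i ∈ ℂ^{Nc × K Nc}` of the `i`-th radio head. -/
def channelMatrix (H : Fin M → UE K Nc → ℂ) (i : Fin M) : Matrix (Fin Nc) (UE K Nc) ℂ :=
  Matrix.of fun c u => if u.1 = c then H i u else 0

/-- The local compression matrix `A_i ∈ ℂ^{R × Nc}`, with entries `√(1/(MR)) exp(j θ_{irc})`. -/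
def compression (θ : Fin M → Fin R → Fin Nc → ℝ) (i : Fin M) : Matrix (Fin R) (Fin Nc) ℂ :=
  Matrix.of fun r c => (Real.sqrt (1 / ((M : ℝ) * R)) : ℂ) * Complex.exp ((θ i r c : ℂ) * Complex.I)

/-- The aggregate measurement matrix, with blocks `A_i H_i`. -/
def measMatrix (A : Fin M → Matrix (Fin R) (Fin Nc) ℂ) (H : Fin M → UE K Nc → ℂ) :
    Matrix (Fin M × Fin R) (UE K Nc) ℂ :=
  Matrix.of fun q u => (A q.1 * channelMatrix H q.1) q.2 u

/-- The compressed data `z`, with blocks `z_i = A_i (H_i x + n_i)`. -/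
def compressed (A : Fin M → Matrix (Fin R) (Fin Nc) ℂ) (H : Fin M → UE K Nc → ℂ)
    (x : UE K Nc → ℂ) (n : Fin M → Fin Nc → ℂ) : Fin M × Fin R → ℂ :=
  fun q => ((A q.1).mulVec ((channelMatrix H q.1).mulVec x + n q.1)) q.2

end System

/-- The random uplink system. `T` is the set of active users, `P` their transmit SNRs, `gbar` the
bound on the large scale fading `g`; `h` is the small scale fading, `θ` the phases of the
compression matrices, `x` the transmitted symbols and `n` the receiver noise. -/
structure UplinkModel {Ω : Type*} [MeasurableSpace Ω] (μ : Measure Ω) {M K Nc R : ℕ}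
    (T : Finset (UE K Nc)) (P : UE K Nc → NNReal) (gbar : ℝ)
    (g : Ω → Fin M → UE K Nc → ℝ) (h : Ω → Fin M → UE K Nc → ℂ)
    (θ : Ω → Fin M → Fin R → Fin Nc → ℝ)
    (x : Ω → UE K Nc → ℂ) (n : Ω → Fin M → Fin Nc → ℂ) : Prop where
  g_measurable : Measurable g
  g_mem : ∀ᵐ ω ∂μ, ∀ i u, g ω i u ∈ Set.Icc 0 gbar
  g_norm : ∀ᵐ ω ∂μ, ∀ u, ∑ i, (g ω i u) ^ 2 = M
  g_moment : ∀ i u, ∫ ω, (g ω i u) ^ 2 ∂μ = 1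
  g_indep : Pairwise fun u v : UE K Nc =>
    IndepFun (fun ω => fun i => g ω i u) (fun ω => fun i => g ω i v) μ
  h_law : ∀ i u, HasLaw (fun ω => h ω i u) (complexGaussian 1) μ
  h_indep : iIndepFun (fun (p : Fin M × UE K Nc) ω => h ω p.1 p.2) μ
  θ_law : ∀ i r c, HasLaw (fun ω => θ ω i r c) (cond volume (Set.Ico 0 (2 * Real.pi))) μ
  θ_indep : iIndepFun (fun (p : Fin M × Fin R × Fin Nc) ω => θ ω p.1 p.2.1 p.2.2) μ
  n_law : ∀ i c, HasLaw (fun ω => n ω i c) (complexGaussian 1) μ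
  n_indep : iIndepFun (fun (p : Fin M × Fin Nc) ω => n ω p.1 p.2) μ
  P_pos : ∀ u ∈ T, 0 < P u
  x_law : ∀ u ∈ T, HasLaw (fun ω => x ω u) (complexGaussian (P u)) μ
  x_zero : ∀ᵐ ω ∂μ, ∀ u ∉ T, x ω u = 0
  /- the families `g`, `h`, `θ`, `n`, `x` are mutually independent -/
  indep_h : IndepFun h g μ
  indep_θ : IndepFun θ (fun ω => (g ω, h ω)) μ
  indep_n : IndepFun n (fun ω => (g ω, h ω, θ ω)) μ
  indep_x : IndepFun x (fun ω => (g ω, h ω, θ ω, n ω)) μ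

/-- The measurement matrix as a random matrix. -/
def randTheta {Ω : Type*} {M K Nc R : ℕ}
    (g : Ω → Fin M → UE K Nc → ℝ) (h : Ω → Fin M → UE K Nc → ℂ)
    (θ : Ω → Fin M → Fin R → Fin Nc → ℝ) (ω : Ω) : Matrix (Fin M × Fin R) (UE K Nc) ℂ :=
  measMatrix (compression (θ ω)) (channel (g ω) (h ω))

/-- The compressed data as a random vector. -/
def randZ {Ω : Type*} {M K Nc R : ℕ}
    (g : Ω → Fin M → UE K Nc → ℝ) (h : Ω → Fin M → UE K Nc → ℂ)
    (θ : Ω → Fin M → Fin R → Fin Nc → ℝ) (x : Ω → UE K Nc → ℂ) (n : Ω → Fin M → Fin Nc → ℂ)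
    (ω : Ω) : Fin M × Fin R → ℂ :=
  compressed (compression (θ ω)) (channel (g ω) (h ω)) (x ω) (n ω)

/-- `c₁ = (λ² - Nc) / (4 Nc)`. -/
def c1 (lam : ℝ) (Nc : ℕ) : ℝ := (lam ^ 2 - Nc) / (4 * Nc)

/-- `c₂ = 4 √(1+δ) / (1 - (1+√2) δ)`. -/
def c2 (δ : ℝ) : ℝ := 4 * (Real.sqrt (1 + δ) / (1 - (1 + Real.sqrt 2) * δ))

end CRAN

end

open CRAN

/-! ### Sets of largest entries and sums over blocks -/

namespace CRAN

/-! The core is deterministic (`IsDetectedSet.eq_of_RIP`): if `Θ` has the restricted isometry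
property of order `2s`, the compressed noise has norm at most `λ`, and every active symbol exceeds
`√2 c₂ λ` in modulus, then detection is exact. Candès' argument (`l2norm_sub_le_of_RIP`) bounds the
`ℓ₂` error of basis pursuit by `c₂ λ`. If an inactive user were ranked before an active one, the
active symbol would be at most the sum of two entries of the error, hence at most `√2 c₂ λ`; so the
active users come first. Once all are selected, the projection leaves at most the noise and the test
succeeds; before that, a missed symbol is too large, by the isometry property, for the residual to
be below `λ`.

It remains to bound two failures inside the isometry event; each bound carries the probability of
that event as a factor. Noise and isometry share the random phases and need not be independent, so
one conditions on `(g, h, θ)` and applies a Chernoff bound valid for all phases: each entry of `A_i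
n_i` has law `𝒞𝒩(0, Nc/(MR))`, Jensen's inequality handles the dependent rows of one head, and the
heads are independent (`measure_lt_l2norm_noiseVec_le`). The symbols are independent of `Θ`,
`|x(u)|²` is exponential of mean `P_u`, and a union bound over the active users suffices
(`UplinkModel.measure_RIP_inter_symbol_le`). -/

/-- Block arguments use the ordering by size only through such a top-`s` subset, so no sorted
enumeration is needed. -/
theorem exists_subset_card_eq_forall_le {α : Type*} [DecidableEq α] (f : α → ℝ) (A : Finset α)
    (s : ℕ) (hs : s ≤ A.card) :
    ∃ B ⊆ A, B.card = s ∧ ∀ i ∈ B, ∀ j ∈ A \ B, f j ≤ f i := by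
  induction s with
  | zero => exact ⟨∅, by simp, rfl, by simp⟩
  | succ s ih =>
    obtain ⟨B, hBA, hB, hmax⟩ := ih (by omega)
    have hne : (A \ B).Nonempty := by
      rw [← Finset.card_pos, Finset.card_sdiff_of_subset hBA]
      omega
    obtain ⟨m, hm, hmm⟩ := Finset.exists_max_image (A \ B) f hne
    obtain ⟨hmA, hmB⟩ := Finset.mem_sdiff.1 hm
    refine ⟨insert m B, Finset.insert_subset hmA hBA, by rw [Finset.card_insert_of_notMem hmB, hB],
      fun i hi j hj => ?_⟩
    have hj' : j ∈ A \ B := by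
      simp only [Finset.mem_sdiff, Finset.mem_insert, not_or] at hj ⊢
      exact ⟨hj.1, hj.2.2⟩
    rcases Finset.mem_insert.1 hi with rfl | hi
    · exact hmm j hj'
    · exact hmax i hi j hj'

/-- A subadditive function of sets controlled by the `ℓ₂` norm on sets of size at most `s` is
controlled by the `ℓ₁` norm and the largest entry. -/
theorem sqrt_mul_le_of_subadditive {α : Type*} [DecidableEq α] {f : α → ℝ} (hf : ∀ i, 0 ≤ f i)
    {s : ℕ} (hs : 0 < s) {G : Finset α → ℝ} {C : ℝ} (hC : 0 ≤ C)
    (hsub : ∀ B B', Disjoint B B' → G (B ∪ B') ≤ G B + G B') (A : Finset α)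
    (hG : ∀ B ⊆ A, B.card ≤ s → G B ≤ C * Real.sqrt (∑ i ∈ B, f i ^ 2))
    {m : ℝ} (hm0 : 0 ≤ m) (hm : ∀ i ∈ A, f i ≤ m) :
    Real.sqrt s * G A ≤ C * (s * m + ∑ i ∈ A, f i) := by
  induction hn : A.card using Nat.strong_induction_on generalizing A m with
  | _ n ih =>
    have small : ∀ B ⊆ A, B.card ≤ s → Real.sqrt s * G B ≤ C * (s * m) := by
      intro B hB hc
      have h1 : Real.sqrt (∑ i ∈ B, f i ^ 2) ≤ Real.sqrt s * m := by
        rw [Real.sqrt_le_left (by positivity), mul_pow, Real.sq_sqrt (by positivity)]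
        calc ∑ i ∈ B, f i ^ 2 ≤ ∑ i ∈ B, m ^ 2 :=
              Finset.sum_le_sum fun i hi => pow_le_pow_left₀ (hf i) (hm i (hB hi)) 2
          _ = B.card * m ^ 2 := by rw [Finset.sum_const, nsmul_eq_mul]
          _ ≤ s * m ^ 2 := by gcongr
      calc Real.sqrt s * G B ≤ Real.sqrt s * (C * (Real.sqrt s * m)) := by
            gcongr
            exact (hG B hB hc).trans (by gcongr)
        _ = C * ((Real.sqrt s * Real.sqrt s) * m) := by ring
        _ = C * (s * m) := by rw [Real.mul_self_sqrt (by positivity)]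
    by_cases hc : A.card ≤ s
    · have h0 : 0 ≤ ∑ i ∈ A, f i := Finset.sum_nonneg fun i _ => hf i
      exact (small A subset_rfl hc).trans (by gcongr; linarith)
    · push Not at hc
      obtain ⟨B, hBA, hB, hmax⟩ := exists_subset_card_eq_forall_le f A s hc.le
      have hne : B.Nonempty := by rw [← Finset.card_pos]; omega
      -- The least value on `B` dominates all remaining entries, while `s` times it is at most the
      -- sum over `B`. The sum over `B` thus pays for the term `s * m` of the next block, and the
      -- induction telescopes.
      obtain ⟨b, hb, hbm⟩ := Finset.exists_min_image B f hne
      have hm' : (s : ℝ) * f b ≤ ∑ i ∈ B, f i := by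
        rw [← hB, ← nsmul_eq_mul]
        exact Finset.card_nsmul_le_sum _ _ _ hbm
      have hGr : ∀ D ⊆ A \ B, D.card ≤ s → G D ≤ C * Real.sqrt (∑ i ∈ D, f i ^ 2) :=
        fun D hD => hG D (hD.trans Finset.sdiff_subset)
      have hrest := ih (A \ B).card
        (by rw [Finset.card_sdiff_of_subset hBA]; omega) (A \ B) hGr (hf b)
        (fun j hj => hmax b hb j hj) rfl
      have hfirst := small B hBA hB.le
      have hun : G A ≤ G B + G (A \ B) := by
        have := hsub B (A \ B) Finset.disjoint_sdiff
        rwa [Finset.union_sdiff_of_subset hBA] at this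
      have hsum : ∑ i ∈ A, f i = ∑ i ∈ B, f i + ∑ i ∈ A \ B, f i := by
        rw [add_comm, Finset.sum_sdiff hBA]
      calc Real.sqrt s * G A ≤ Real.sqrt s * G B + Real.sqrt s * G (A \ B) := by
            rw [← mul_add]; gcongr
        _ ≤ C * (s * m) + C * (s * f b + ∑ i ∈ A \ B, f i) := add_le_add hfirst hrest
        _ ≤ C * (s * m) + C * (∑ i ∈ B, f i + ∑ i ∈ A \ B, f i) := by gcongr
        _ = C * (s * m + ∑ i ∈ A, f i) := by rw [hsum]; ring

section Restrict

variable {ι : Type*} [DecidableEq ι]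

/-- The vector which agrees with `v` on `B` and vanishes elsewhere. -/
def restrictTo (B : Finset ι) (v : ι → ℂ) : ι → ℂ := fun i => if i ∈ B then v i else 0

theorem restrictTo_union {B D : Finset ι} (h : Disjoint B D) (v : ι → ℂ) :
    restrictTo (B ∪ D) v = restrictTo B v + restrictTo D v := by
  funext i
  by_cases hB : i ∈ B
  · simp [restrictTo, hB, Finset.disjoint_left.1 h hB]
  · simp [restrictTo, hB]

theorem restrictTo_apply_of_notMem {B : Finset ι} {i : ι} (hi : i ∉ B) (v : ι → ℂ) :
    restrictTo B v i = 0 := by simp [restrictTo, hi]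

end Restrict

theorem l0norm_le_card {ι : Type*} {v : ι → ℂ} {B : Finset ι} (h : ∀ i ∉ B, v i = 0) :
    l0norm v ≤ B.card := by
  rw [← Set.ncard_coe_finset B]
  refine Set.ncard_le_ncard (fun i hi => ?_) B.finite_toSet
  by_contra hB
  exact hi (h i hB)

/-! ### Restricted isometry and stable recovery by basis pursuit -/

section SparseRecovery

variable {κ ι : Type*} [Fintype κ] [Fintype ι]

theorem l2norm_sq (v : ι → ℂ) : l2norm v ^ 2 = ∑ i, ‖v i‖ ^ 2 := by
  simp [l2norm, EuclideanSpace.norm_sq_eq]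

theorem l2norm_nonneg (v : ι → ℂ) : 0 ≤ l2norm v := norm_nonneg _

theorem l2norm_add_le (v w : ι → ℂ) : l2norm (v + w) ≤ l2norm v + l2norm w := by
  simpa [l2norm] using norm_add_le (WithLp.toLp 2 v : EuclideanSpace ℂ ι) (WithLp.toLp 2 w)

theorem l2norm_neg (v : ι → ℂ) : l2norm (-v) = l2norm v := by
  simp [l2norm]

theorem l2norm_sub_le (v w : ι → ℂ) : l2norm (v - w) ≤ l2norm v + l2norm w := by
  rw [sub_eq_add_neg, ← l2norm_neg w]
  exact l2norm_add_le _ _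

theorem l2norm_smul (c : ℂ) (v : ι → ℂ) : l2norm (c • v) = ‖c‖ * l2norm v := by
  simpa [l2norm] using norm_smul c (WithLp.toLp 2 v : EuclideanSpace ℂ ι)

theorem l2norm_eq_zero {v : ι → ℂ} : l2norm v = 0 ↔ v = 0 := by
  simp [l2norm]

theorem norm_sq_add_norm_sq_le (v : ι → ℂ) {i j : ι} (hij : i ≠ j) :
    ‖v i‖ ^ 2 + ‖v j‖ ^ 2 ≤ l2norm v ^ 2 := by
  classical
  rw [l2norm_sq, ← Finset.sum_pair (f := fun i => ‖v i‖ ^ 2) hij]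
  exact Finset.sum_le_sum_of_subset_of_nonneg (Finset.subset_univ _) fun _ _ _ => by positivity

theorem norm_apply_le_l2norm (v : ι → ℂ) (i : ι) : ‖v i‖ ≤ l2norm v := by
  simpa [l2norm] using PiLp.norm_apply_le (WithLp.toLp 2 v : EuclideanSpace ℂ ι) i

/-- The real part of the inner product. -/
noncomputable def reInner (v w : ι → ℂ) : ℝ :=
  RCLike.re (inner ℂ (WithLp.toLp 2 v : EuclideanSpace ℂ ι) (WithLp.toLp 2 w))

theorem reInner_add_left (u v w : ι → ℂ) : reInner (u + v) w = reInner u w + reInner v w := by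
  simp [reInner, WithLp.toLp_add]

theorem reInner_add_right (u v w : ι → ℂ) : reInner u (v + w) = reInner u v + reInner u w := by
  simp [reInner, WithLp.toLp_add]

theorem reInner_self (v : ι → ℂ) : reInner v v = l2norm v ^ 2 :=
  inner_self_eq_norm_sq _

theorem abs_reInner_le (v w : ι → ℂ) : |reInner v w| ≤ l2norm v * l2norm w :=
  (RCLike.abs_re_le_norm _).trans (norm_inner_le_norm _ _)

theorem l2norm_add_sq (v w : ι → ℂ) :
    l2norm (v + w) ^ 2 = l2norm v ^ 2 + 2 * reInner v w + l2norm w ^ 2 := by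
  simpa [l2norm, reInner] using
    norm_add_sq (𝕜 := ℂ) (WithLp.toLp 2 v : EuclideanSpace ℂ ι) (WithLp.toLp 2 w)

theorem reInner_real_smul (a b : ℝ) (v w : ι → ℂ) :
    reInner ((a : ℂ) • v) ((b : ℂ) • w) = a * b * reInner v w := by
  simp [reInner]
  ring

theorem reInner_neg_right (v w : ι → ℂ) : reInner v (-w) = -reInner v w := by
  simp [reInner, WithLp.toLp_neg, inner_neg_right]

section Restrict

variable [DecidableEq ι]

theorem restrictTo_univ (v : ι → ℂ) : restrictTo Finset.univ v = v := by
  funext i; simp [restrictTo]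

theorem l2norm_restrictTo_sq (B : Finset ι) (v : ι → ℂ) :
    l2norm (restrictTo B v) ^ 2 = ∑ i ∈ B, ‖v i‖ ^ 2 := by
  rw [l2norm_sq, ← Finset.sum_subset (Finset.subset_univ B)]
  · exact Finset.sum_congr rfl fun i hi => by simp [restrictTo, hi]
  · intro i _ hi
    simp [restrictTo, hi]

theorem l2norm_restrictTo (B : Finset ι) (v : ι → ℂ) :
    l2norm (restrictTo B v) = Real.sqrt (∑ i ∈ B, ‖v i‖ ^ 2) := by
  rw [← l2norm_restrictTo_sq, Real.sqrt_sq (l2norm_nonneg _)]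

end Restrict

/-- Polarization: `v + w` and `v - w` are `k`-sparse and, having disjointly supported summands, of
equal norm. Subtracting the lower isometry bound for one from the upper bound for the other leaves
the inner product. -/
theorem reInner_le_of_RIP [DecidableEq ι] {Θ : Matrix κ ι ℂ} {k : ℕ} {δ : ℝ} (hΘ : RIP Θ k δ)
    {B D : Finset ι} (hBD : Disjoint B D) (hk : B.card + D.card ≤ k) (v w : ι → ℂ)
    (hv : ∀ i ∉ B, v i = 0) (hw : ∀ i ∉ D, w i = 0) :
    reInner (Θ.mulVec v) (Θ.mulVec w) ≤ δ * (l2norm v * l2norm w) := by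
  have key : ∀ v w : ι → ℂ, (∀ i ∉ B, v i = 0) → (∀ i ∉ D, w i = 0) →
      2 * reInner (Θ.mulVec v) (Θ.mulVec w) ≤ δ * (l2norm v ^ 2 + l2norm w ^ 2) := by
    intro v w hv hw
    have horth : reInner v w = 0 := by
      simp only [reInner, PiLp.inner_apply]
      rw [Finset.sum_eq_zero, map_zero]
      intro i _
      by_cases hB : i ∈ B
      · simp [hw i (Finset.disjoint_left.1 hBD hB)]
      · simp [hv i hB]
    have hsupp : ∀ w' : ι → ℂ, (∀ i ∉ D, w' i = 0) → l0norm (v + w') ≤ k := by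
      intro w' hw'
      refine (l0norm_le_card (B := B ∪ D) fun i hi => ?_).trans
        ((Finset.card_union_le _ _).trans hk)
      simp only [Finset.mem_union, not_or] at hi
      simp [hv i hi.1, hw' i hi.2]
    have h1 := (hΘ.2.2 (v + w) (hsupp w hw)).2
    have h2 := (hΘ.2.2 (v + -w) (hsupp (-w) fun i hi => by simp [hw i hi])).1
    rw [Matrix.mulVec_add, l2norm_add_sq, l2norm_add_sq, horth] at h1
    rw [Matrix.mulVec_add, Matrix.mulVec_neg, l2norm_add_sq, l2norm_add_sq, reInner_neg_right,
      reInner_neg_right, horth, l2norm_neg, l2norm_neg] at h2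
    linarith
  rcases eq_or_ne v 0 with rfl | hv0
  · simpa using (abs_le.1 (abs_reInner_le (Θ.mulVec 0) (Θ.mulVec w))).2.trans
      (by simp [l2norm])
  rcases eq_or_ne w 0 with rfl | hw0
  · simpa using (abs_le.1 (abs_reInner_le (Θ.mulVec v) (Θ.mulVec 0))).2.trans
      (by simp [l2norm])
  have ha : 0 < l2norm v := (l2norm_nonneg v).lt_of_ne' fun h => hv0 (l2norm_eq_zero.1 h)
  have hb : 0 < l2norm w := (l2norm_nonneg w).lt_of_ne' fun h => hw0 (l2norm_eq_zero.1 h)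
  -- The scaling gives both vectors the norm `‖v‖‖w‖`, which turns the sum of squares in `key` into
  -- a product.
  have h := key ((l2norm w : ℂ) • v) ((l2norm v : ℂ) • w) (fun i hi => by simp [hv i hi])
    (fun i hi => by simp [hw i hi])
  rw [Matrix.mulVec_smul, Matrix.mulVec_smul, reInner_real_smul, l2norm_smul, l2norm_smul,
    Complex.norm_real, Complex.norm_real, Real.norm_of_nonneg ha.le,
    Real.norm_of_nonneg hb.le] at h
  refine le_of_mul_le_mul_left ?_ (mul_pos ha hb)
  nlinarith

theorem abs_reInner_le_of_RIP [DecidableEq ι] {Θ : Matrix κ ι ℂ} {k : ℕ} {δ : ℝ}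
    (hΘ : RIP Θ k δ) {B D : Finset ι} (hBD : Disjoint B D) (hk : B.card + D.card ≤ k)
    (v w : ι → ℂ) (hv : ∀ i ∉ B, v i = 0) (hw : ∀ i ∉ D, w i = 0) :
    |reInner (Θ.mulVec v) (Θ.mulVec w)| ≤ δ * (l2norm v * l2norm w) := by
  refine abs_le.2 ⟨?_, reInner_le_of_RIP hΘ hBD hk v w hv hw⟩
  have := reInner_le_of_RIP hΘ hBD hk v (-w) hv fun i hi => by simp [hw i hi]
  rw [Matrix.mulVec_neg, reInner_neg_right, l2norm_neg] at this
  linarith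

/-- The error of basis pursuit lies in the cone of vectors concentrated on the true support. -/
theorem sum_compl_le_sum_of_l1norm_le [DecidableEq ι] {x y : ι → ℂ} {T : Finset ι}
    (hx : ∀ i ∉ T, x i = 0) (hle : l1norm y ≤ l1norm x) :
    ∑ i ∈ Tᶜ, ‖(y - x) i‖ ≤ ∑ i ∈ T, ‖(y - x) i‖ := by
  have h1 : l1norm x = ∑ i ∈ T, ‖x i‖ := by
    rw [l1norm, ← Finset.sum_subset (Finset.subset_univ T)]
    intro i _ hi
    simp [hx i hi]
  have h2 : l1norm y = ∑ i ∈ T, ‖y i‖ + ∑ i ∈ Tᶜ, ‖y i‖ := (Finset.sum_add_sum_compl T _).symm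
  have h3 : ∑ i ∈ Tᶜ, ‖(y - x) i‖ = ∑ i ∈ Tᶜ, ‖y i‖ :=
    Finset.sum_congr rfl fun i hi => by simp [hx i (Finset.mem_compl.1 hi)]
  have h4 : ∑ i ∈ T, ‖x i‖ ≤ ∑ i ∈ T, ‖y i‖ + ∑ i ∈ T, ‖(y - x) i‖ := by
    rw [← Finset.sum_add_distrib]
    refine Finset.sum_le_sum fun i _ => ?_
    have := norm_sub_le (y i) ((y - x) i)
    simpa using this
  linarith

theorem one_sub_mul_pos {δ : ℝ} (hδ : δ < Real.sqrt 2 - 1) : 0 < 1 - (1 + Real.sqrt 2) * δ := by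
  have h2 : Real.sqrt 2 * Real.sqrt 2 = 2 := Real.mul_self_sqrt (by norm_num)
  have h1 : 0 < 1 + Real.sqrt 2 := by positivity
  nlinarith

/-- Stable recovery by basis pursuit under the restricted isometry property. -/
theorem l2norm_sub_le_of_RIP [DecidableEq ι] {Θ : Matrix κ ι ℂ} {T : Finset ι} {δ lam : ℝ}
    (hT : T.Nonempty) (hΘ : RIP Θ (2 * T.card) δ) (hδ : δ < Real.sqrt 2 - 1) {z : κ → ℂ}
    {x y : ι → ℂ} (hx : ∀ i ∉ T, x i = 0) (hxf : x ∈ bpFeasible Θ z lam)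
    (hy : IsBPSolution Θ z lam y) : l2norm (y - x) ≤ c2 δ * lam := by
  set h := y - x with hh
  have hs : 0 < T.card := hT.card_pos
  have hsR : (0 : ℝ) < Real.sqrt T.card := Real.sqrt_pos.2 (by exact_mod_cast hs)
  have hcone := sum_compl_le_sum_of_l1norm_le hx (hy.2 x hxf)
  rw [← hh] at hcone
  have hΘh : l2norm (Θ.mulVec h) ≤ 2 * lam := by
    have e : Θ.mulVec h = (Θ.mulVec y - z) - (Θ.mulVec x - z) := by
      rw [hh, Matrix.mulVec_sub]; abel
    rw [e]
    have h1 := hy.1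
    simp only [bpFeasible, Set.mem_ofPred_eq] at h1 hxf
    exact (l2norm_sub_le _ _).trans (by linarith)
  have hf : ∀ i, 0 ≤ ‖h i‖ := fun i => norm_nonneg _
  have h10 : ∑ i ∈ T, ‖h i‖ ≤ Real.sqrt T.card * l2norm (restrictTo T h) := by
    rw [l2norm_restrictTo, ← Real.sqrt_mul (by positivity)]
    exact Real.le_sqrt_of_sq_le sq_sum_le_card_mul_sum_sq
  -- `B` carries the largest entries of the error off `T`, and `m` is its least value. If fewer than
  -- `T.card` indices lie off `T`, then `B = Tᶜ`, nothing remains, and `m = 0` will do.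
  obtain ⟨B, hBT, hBs, m, hm0, hm, hsm⟩ : ∃ B ⊆ Tᶜ, B.card ≤ T.card ∧ ∃ m : ℝ, 0 ≤ m ∧
      (∀ i ∈ Tᶜ \ B, ‖h i‖ ≤ m) ∧ T.card * m ≤ ∑ i ∈ B, ‖h i‖ := by
    by_cases hc : T.card ≤ Tᶜ.card
    · obtain ⟨B, hBA, hB, hmax⟩ := exists_subset_card_eq_forall_le (fun i => ‖h i‖) Tᶜ T.card hc
      have hne : B.Nonempty := by rw [← Finset.card_pos]; omega
      obtain ⟨b, hb, hbm⟩ := Finset.exists_min_image B (fun i => ‖h i‖) hne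
      refine ⟨B, hBA, hB.le, ‖h b‖, norm_nonneg _, hmax b hb, ?_⟩
      rw [← hB, ← nsmul_eq_mul]
      exact Finset.card_nsmul_le_sum _ _ _ hbm
    · exact ⟨Tᶜ, subset_rfl, by omega, 0, le_rfl, by simp, by
        simpa using Finset.sum_nonneg fun i _ => hf i⟩
  have hdTB : Disjoint T B := Finset.disjoint_of_subset_right hBT disjoint_compl_right
  set A := Tᶜ \ B with hA
  have hdA : Disjoint (T ∪ B) A := by
    rw [hA, Finset.disjoint_left]
    intro i hi
    simp only [Finset.mem_union, Finset.mem_sdiff, Finset.mem_compl] at hi ⊢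
    tauto
  have hun : (T ∪ B) ∪ A = Finset.univ := by
    ext i
    simp only [hA, Finset.mem_union, Finset.mem_sdiff, Finset.mem_compl, Finset.mem_univ, iff_true]
    tauto
  have hTA : Disjoint T A := Finset.disjoint_of_subset_left Finset.subset_union_left hdA
  have hBA : Disjoint B A := Finset.disjoint_of_subset_left Finset.subset_union_right hdA
  set w := l2norm (restrictTo (T ∪ B) h) with hw
  set a := l2norm (restrictTo T h) with ha
  set b := l2norm (restrictTo B h) with hb
  have hw0 : 0 ≤ w := l2norm_nonneg _
  have ha0 : 0 ≤ a := l2norm_nonneg _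
  have hb0 : 0 ≤ b := l2norm_nonneg _
  have hwab : w ^ 2 = a ^ 2 + b ^ 2 := by
    rw [hw, ha, hb, l2norm_restrictTo_sq, l2norm_restrictTo_sq, l2norm_restrictTo_sq,
      Finset.sum_union hdTB]
  have haw : a ≤ w := by nlinarith
  have hab : a + b ≤ Real.sqrt 2 * w := by
    rw [← Real.sqrt_sq hw0, ← Real.sqrt_mul (by norm_num)]
    refine Real.le_sqrt_of_sq_le ?_
    nlinarith [sq_nonneg (a - b)]
  -- The sum over `B` absorbs `T.card * m`, and the cone condition then bounds the sum off `T` by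
  -- the sum on `T`. This is what makes the tail bound below depend on `a` alone.
  have hsumA : T.card * m + ∑ i ∈ A, ‖h i‖ ≤ Real.sqrt T.card * a := by
    have : ∑ i ∈ Tᶜ, ‖h i‖ = ∑ i ∈ B, ‖h i‖ + ∑ i ∈ A, ‖h i‖ := by
      rw [hA, add_comm, Finset.sum_sdiff hBT]
    linarith
  have htail : ∀ (G : Finset ι → ℝ) (C : ℝ), 0 ≤ C →
      (∀ D D', Disjoint D D' → G (D ∪ D') ≤ G D + G D') →
      (∀ D ⊆ A, D.card ≤ T.card → G D ≤ C * l2norm (restrictTo D h)) → G A ≤ C * a := by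
    intro G C hC hsub hG
    have := sqrt_mul_le_of_subadditive hf hs hC hsub A
      (fun D hD hDs => by rw [← l2norm_restrictTo]; exact hG D hD hDs) hm0 hm
    refine le_of_mul_le_mul_left (this.trans ?_) hsR
    calc _ ≤ C * (Real.sqrt T.card * a) := by gcongr
      _ = _ := by ring
  have hrest : l2norm (restrictTo A h) ≤ a := by
    have := htail (fun D => l2norm (restrictTo D h)) 1 zero_le_one
      (fun D D' hD => by rw [restrictTo_union hD]; exact l2norm_add_le _ _) (fun D _ _ => by simp)
    simpa using this
  have hδ0 := hΘ.1
  -- Order `2s` only allows pairing two sets of size `s`, so `T` and `B` are treated separately; `a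
  -- + b ≤ √2 w` is the source of the `√2` in `c₂`.
  have hcross : |reInner (Θ.mulVec (restrictTo (T ∪ B) h)) (Θ.mulVec (restrictTo A h))| ≤
      δ * (Real.sqrt 2 * w) * a := by
    refine htail (fun D => |reInner (Θ.mulVec (restrictTo (T ∪ B) h))
      (Θ.mulVec (restrictTo D h))|) _ (by positivity) (fun D D' hD => ?_) (fun D hD hDs => ?_)
    · simp only [restrictTo_union hD, Matrix.mulVec_add, reInner_add_right]
      exact abs_add_le _ _
    · have h1 := abs_reInner_le_of_RIP hΘ (Finset.disjoint_of_subset_right hD hTA) (by omega)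
        (restrictTo T h) (restrictTo D h) (fun i hi => restrictTo_apply_of_notMem hi h)
        (fun i hi => restrictTo_apply_of_notMem hi h)
      have h2 := abs_reInner_le_of_RIP hΘ (Finset.disjoint_of_subset_right hD hBA) (by omega)
        (restrictTo B h) (restrictTo D h) (fun i hi => restrictTo_apply_of_notMem hi h)
        (fun i hi => restrictTo_apply_of_notMem hi h)
      simp only [restrictTo_union hdTB, Matrix.mulVec_add, reInner_add_left]
      refine (abs_add_le _ _).trans ((add_le_add h1 h2).trans ?_)
      calc _ = δ * (a + b) * l2norm (restrictTo D h) := by ring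
        _ ≤ _ := by
          have := l2norm_nonneg (restrictTo D h)
          gcongr
  have hsplit : h = restrictTo (T ∪ B) h + restrictTo A h := by
    rw [← restrictTo_union hdA, hun, restrictTo_univ]
  have hrip := hΘ.2.2 (restrictTo (T ∪ B) h) ((l0norm_le_card
    fun i hi => restrictTo_apply_of_notMem hi h).trans ((Finset.card_union_le _ _).trans (by omega)))
  have hup : l2norm (Θ.mulVec (restrictTo (T ∪ B) h)) ≤ Real.sqrt (1 + δ) * w := by
    rw [← Real.sqrt_sq hw0, ← Real.sqrt_mul (by linarith)]
    exact Real.le_sqrt_of_sq_le hrip.2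
  have hmain : (1 - δ) * w ^ 2 ≤ Real.sqrt (1 + δ) * w * (2 * lam) + δ * (Real.sqrt 2 * w) * a := by
    refine hrip.1.trans ?_
    have e : l2norm (Θ.mulVec (restrictTo (T ∪ B) h)) ^ 2 =
        reInner (Θ.mulVec (restrictTo (T ∪ B) h)) (Θ.mulVec h) -
        reInner (Θ.mulVec (restrictTo (T ∪ B) h)) (Θ.mulVec (restrictTo A h)) := by
      conv_rhs => enter [1, 2]; rw [hsplit, Matrix.mulVec_add]
      rw [reInner_add_right, reInner_self]
      ring
    rw [e]
    have h1 := (abs_le.1 (abs_reInner_le (Θ.mulVec (restrictTo (T ∪ B) h)) (Θ.mulVec h))).2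
    have h2 := (abs_le.1 hcross).1
    have h3 : l2norm (Θ.mulVec (restrictTo (T ∪ B) h)) * l2norm (Θ.mulVec h) ≤
        Real.sqrt (1 + δ) * w * (2 * lam) :=
      mul_le_mul hup hΘh (l2norm_nonneg _) (by positivity)
    linarith
  have hden := one_sub_mul_pos hδ
  have hlam : 0 ≤ lam := (l2norm_nonneg _).trans hxf
  have hwle : w ≤ 2 * (Real.sqrt (1 + δ) / (1 - (1 + Real.sqrt 2) * δ)) * lam := by
    rcases hw0.eq_or_lt with h0 | hwpos
    · rw [← h0]; positivity
    -- With `a ≤ w`, `hmain` becomes linear in `w` after division by `w`. The factor `2` here and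
    -- `‖h‖ ≤ 2w` below make the `4` in `c₂`.
    have h2 : δ * (Real.sqrt 2 * w) * a ≤ δ * (Real.sqrt 2 * w) * w := by gcongr
    have h3 : w * ((1 - (1 + Real.sqrt 2) * δ) * w) ≤ w * (2 * Real.sqrt (1 + δ) * lam) := by
      nlinarith
    have h4 := le_of_mul_le_mul_left h3 hwpos
    rw [mul_div_assoc', div_mul_eq_mul_div, le_div_iff₀ hden]
    linarith
  calc l2norm h ≤ w + l2norm (restrictTo A h) := by
        conv_lhs => rw [hsplit]
        exact l2norm_add_le _ _
    _ ≤ 2 * w := by linarith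
    _ ≤ c2 δ * lam := by rw [c2]; linarith

end SparseRecovery

/-! ### Greedy selection and projection residuals -/

theorem mem_firstIndices {ι : Type*} [Fintype ι] {σ : Fin (Fintype.card ι) ≃ ι} {k : ℕ} {u : ι} :
    u ∈ firstIndices σ k ↔ (σ.symm u : ℕ) < k := by
  simp [firstIndices]

theorem card_firstIndices {ι : Type*} [Fintype ι] (σ : Fin (Fintype.card ι) ≃ ι) {k : ℕ}
    (hk : k ≤ Fintype.card ι) : (firstIndices σ k).card = k := by
  classical
  have : firstIndices σ k =
      (Finset.univ.filter fun i : Fin (Fintype.card ι) => (i : ℕ) < k).map σ.toEmbedding := by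
    ext u
    simp [mem_firstIndices, Finset.mem_map_equiv]
  rw [this, Finset.card_map, Fin.card_filter_val_lt, min_eq_right hk]

/-- An index outside `T` among the first `T.card` would be preceded by all of `T`, giving one index
too many. -/
theorem firstIndices_card_eq {ι : Type*} [Fintype ι] {σ : Fin (Fintype.card ι) ≃ ι}
    {T : Finset ι} (h : ∀ i ∈ T, ∀ j ∉ T, σ.symm i < σ.symm j) :
    firstIndices σ T.card = T := by
  classical
  have hc := card_firstIndices σ (Finset.card_le_univ T)
  refine Finset.eq_of_subset_of_card_le (fun u hu => ?_) hc.ge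
  by_contra huT
  have hsub : insert u T ⊆ firstIndices σ T.card := by
    refine Finset.insert_subset hu fun i hi => ?_
    rw [mem_firstIndices] at hu ⊢
    have : (σ.symm i : ℕ) < σ.symm u := h i hi u huT
    omega
  have := Finset.card_le_card hsub
  rw [Finset.card_insert_of_notMem huT] at this
  omega

/-- For an orthogonal projection, `‖Qv‖² = ⟨Qv, v⟩`, and Cauchy–Schwarz applies. -/
theorem l2norm_mulVec_le_of_isProj {κ : Type*} [Fintype κ] {Q : Matrix κ κ ℂ}
    (hQ : Q.conjTranspose = Q) (hQQ : Q * Q = Q)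
    (v : κ → ℂ) : l2norm (Q.mulVec v) ≤ l2norm v := by
  have h : reInner (Q.mulVec v) (Q.mulVec v) = reInner (Q.mulVec v) v := by
    simp only [reInner, EuclideanSpace.inner_toLp_toLp]
    congr 1
    have e : star (Q.mulVec v) = Matrix.vecMul (star v) Q := by
      rw [Matrix.star_mulVec, hQ]
    rw [dotProduct_comm, dotProduct_comm v, e, Matrix.dotProduct_mulVec, Matrix.vecMul_vecMul, hQQ]
  have h2 := (abs_le.1 (abs_reInner_le (Q.mulVec v) v)).2
  rw [← h, reInner_self, sq] at h2
  rcases (l2norm_nonneg (Q.mulVec v)).eq_or_lt with h0 | h0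
  · rw [← h0]; exact l2norm_nonneg v
  · exact le_of_mul_le_mul_left h2 h0

theorem colSub_mulVec {κ ι : Type*} [Fintype ι] (Θ : Matrix κ ι ℂ) (S : Finset ι)
    (x : ι → ℂ) (hx : ∀ i ∉ S, x i = 0) :
    (colSub Θ S).mulVec (fun u => x u) = Θ.mulVec x := by
  funext q
  simp only [Matrix.mulVec, dotProduct, colSub, Matrix.submatrix_apply, id]
  rw [Finset.sum_coe_sort S fun i => Θ q i * x i]
  exact Finset.sum_subset (Finset.subset_univ S) fun i _ hi => by simp [hx i hi]

/-- Since `δ < 1`, the columns indexed by `T` are linearly independent. This rules out a forced stop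
at `k = MR` before `T` is exhausted, and shows that `M` and `R` are positive on the isometry event.
-/
theorem card_le_card_of_RIP {κ ι : Type*} [Fintype κ] [Fintype ι] {Θ : Matrix κ ι ℂ}
    {k : ℕ} {δ : ℝ} (hΘ : RIP Θ k δ) {T : Finset ι}
    (hT : T.card ≤ k) : T.card ≤ Fintype.card κ := by
  classical
  have hinj : Function.Injective (colSub Θ T).mulVecLin := by
    rw [← LinearMap.ker_eq_bot, LinearMap.ker_eq_bot']
    intro v hv
    set v' : ι → ℂ := fun i => if hi : i ∈ T then v ⟨i, hi⟩ else 0 with hv'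
    have h0 : ∀ i ∉ T, v' i = 0 := fun i hi => by simp [hv', hi]
    have hvv : (fun u : {u // u ∈ T} => v' u) = v := by funext u; simp [hv']
    have h1 : Θ.mulVec v' = 0 := by
      rw [← colSub_mulVec Θ T v' h0, hvv]
      exact hv
    have h2 := (hΘ.2.2 v' ((l0norm_le_card h0).trans hT)).1
    rw [h1, l2norm_eq_zero.2 rfl] at h2
    have h3 : l2norm v' = 0 := by
      have := hΘ.2.1
      have h4 : l2norm v' ^ 2 ≤ 0 := by
        by_contra hc
        push Not at hc
        nlinarith
      exact pow_eq_zero_iff (two_ne_zero) |>.1 (le_antisymm h4 (sq_nonneg _))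
    rw [← hvv, l2norm_eq_zero.1 h3]
    rfl
  have := LinearMap.finrank_le_finrank_of_injective hinj
  simpa using this

section Detection

variable {κ ι : Type*} [Fintype κ] [Fintype ι] [DecidableEq κ]

/-- `I - A A†` annihilates the range of `A` because `A A† A = A`, and as an orthogonal projection it
does not enlarge the noise. -/
theorem residual_le (Θ : Matrix κ ι ℂ) {T : Finset ι} {x : ι → ℂ} (hx : ∀ i ∉ T, x i = 0)
    (e : κ → ℂ) : residual Θ (Θ.mulVec x + e) T ≤ l2norm e := by
  have hP := isMoorePenrose_pinv (colSub Θ T)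
  set P := colSub Θ T * pinv (colSub Θ T) with hPdef
  have hz : (1 - P).mulVec (Θ.mulVec x + e) = (1 - P).mulVec e := by
    rw [← colSub_mulVec Θ T x hx, Matrix.mulVec_add, Matrix.mulVec_mulVec, Matrix.sub_mul,
      Matrix.one_mul, hP.mul_mul_left, sub_self, Matrix.zero_mulVec, zero_add]
  rw [residual, hz]
  refine l2norm_mulVec_le_of_isProj ?_ ?_ e
  · rw [Matrix.conjTranspose_sub, Matrix.conjTranspose_one, hP.herm_left]
  · have hPP : P * P = P := by
      conv_lhs => rw [hPdef, ← Matrix.mul_assoc, hP.mul_mul_left]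
    simp [Matrix.sub_mul, Matrix.mul_sub, hPP]

/-- The residual is the distance to a vector which agrees with `x` off `S`. -/
theorem exists_residual_eq (Θ : Matrix κ ι ℂ) (S : Finset ι) (x : ι → ℂ) (e : κ → ℂ) :
    ∃ w : ι → ℂ, (∀ i ∉ S, w i = x i) ∧
      residual Θ (Θ.mulVec x + e) S = l2norm (Θ.mulVec w + e) := by
  classical
  set y := (pinv (colSub Θ S)).mulVec (Θ.mulVec x + e) with hy
  set y' : ι → ℂ := fun i => if hi : i ∈ S then y ⟨i, hi⟩ else 0 with hy'
  refine ⟨x - y', fun i hi => by simp [hy', hi], ?_⟩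
  have h1 : (colSub Θ S).mulVec y = Θ.mulVec y' := by
    rw [← colSub_mulVec Θ S y' fun i hi => by simp [hy', hi]]
    congr 1
    funext u
    simp [hy']
  rw [residual, Matrix.sub_mulVec, Matrix.one_mulVec, ← Matrix.mulVec_mulVec, ← hy, h1,
    Matrix.mulVec_sub]
  congr 1
  abel

theorem four_le_c2 {δ : ℝ} (h0 : 0 ≤ δ) (hδ : δ < Real.sqrt 2 - 1) : 4 ≤ c2 δ := by
  have hden := one_sub_mul_pos hδ
  have h1 : 1 ≤ Real.sqrt (1 + δ) := Real.one_le_sqrt.2 (by linarith)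
  have h2 : 1 ≤ Real.sqrt (1 + δ) / (1 - (1 + Real.sqrt 2) * δ) := by
    rw [le_div_iff₀ hden]
    have : 0 ≤ (1 + Real.sqrt 2) * δ := by positivity
    linarith
  rw [c2]
  linarith

/-- Active user detection succeeds when the measurement matrix has the restricted isometry
property, the noise is bounded and the active symbols are large enough. -/
theorem IsDetectedSet.eq_of_RIP {Θ : Matrix κ ι ℂ} {T S : Finset ι} {δ lam : ℝ}
    (hT : T.Nonempty) (hΘ : RIP Θ (2 * T.card) δ) (hδ : δ < Real.sqrt 2 - 1) (hlam : 0 < lam)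
    {x : ι → ℂ} (hx : ∀ i ∉ T, x i = 0) (hmin : ∀ i ∈ T, Real.sqrt 2 * (c2 δ * lam) < ‖x i‖)
    {e : κ → ℂ} (he : l2norm e ≤ lam) (hS : IsDetectedSet Θ (Θ.mulVec x + e) lam S) : S = T := by
  classical
  obtain ⟨y, hy, σ, hσ, k, hk1, hkc, hdone, hfirst, rfl⟩ := hS
  have hxf : x ∈ bpFeasible Θ (Θ.mulVec x + e) lam := by
    change l2norm (Θ.mulVec x - (Θ.mulVec x + e)) ≤ lam
    rwa [sub_add_cancel_left, l2norm_neg]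
  have herr := l2norm_sub_le_of_RIP hT hΘ hδ hx hxf hy
  have hc4 := four_le_c2 hΘ.1 hδ
  have hsqrt2 : Real.sqrt 2 * Real.sqrt 2 = 2 := Real.mul_self_sqrt (by norm_num)
  have horder : ∀ i ∈ T, ∀ j ∉ T, σ.symm i < σ.symm j := by
    intro i hi j hj
    by_contra hle
    push Not at hle
    have h1 : ‖y i‖ ≤ ‖y j‖ := by simpa using hσ hle
    have hij : i ≠ j := fun h => hj (h ▸ hi)
    have h2 := norm_sq_add_norm_sq_le (y - x) hij
    have h3 : ‖x i‖ ≤ ‖y i‖ + ‖(y - x) i‖ := by simpa using norm_sub_le (y i) ((y - x) i)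
    have h4 : ‖(y - x) j‖ = ‖y j‖ := by simp [hx j hj]
    have h5 : ‖x i‖ ≤ ‖(y - x) i‖ + ‖(y - x) j‖ := by linarith
    -- `(p + q)² ≤ 2(p² + q²)` for two distinct entries of the error: this is the reason for the
    -- `√2` in `hmin`.
    have h6 : ‖x i‖ ^ 2 ≤ 2 * (c2 δ * lam) ^ 2 := by
      have h7 : l2norm (y - x) ^ 2 ≤ (c2 δ * lam) ^ 2 :=
        pow_le_pow_left₀ (l2norm_nonneg _) herr 2
      have h8 : ‖x i‖ ^ 2 ≤ (‖(y - x) i‖ + ‖(y - x) j‖) ^ 2 :=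
        pow_le_pow_left₀ (norm_nonneg _) h5 2
      nlinarith [sq_nonneg (‖(y - x) i‖ - ‖(y - x) j‖)]
    have h9 : (Real.sqrt 2 * (c2 δ * lam)) ^ 2 < ‖x i‖ ^ 2 :=
      pow_lt_pow_left₀ (hmin i hi) (by positivity) two_ne_zero
    rw [mul_pow, Real.sq_sqrt (by norm_num)] at h9
    linarith
  have hfT : firstIndices σ T.card = T := firstIndices_card_eq horder
  have hdoneT : GreedyStop Θ (Θ.mulVec x + e) lam σ T.card := by
    left
    rw [hfT]
    exact (residual_le Θ hx e).trans he
  have hkT : k ≤ T.card := by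
    by_contra hc
    exact hfirst T.card hT.card_pos (by omega) hdoneT
  rcases hkT.eq_or_lt with rfl | hlt
  · exact hfT
  exfalso
  have hcard := card_le_card_of_RIP hΘ (T := T) (by omega)
  rcases hdone with hres | hkκ
  · have hsub : firstIndices σ k ⊆ T := by
      rw [← hfT]
      intro u hu
      rw [mem_firstIndices] at hu ⊢
      omega
    obtain ⟨u, huT, huS⟩ : ∃ u ∈ T, u ∉ firstIndices σ k := by
      by_contra hc
      push Not at hc
      have := Finset.card_le_card (show T ⊆ firstIndices σ k from hc)
      rw [card_firstIndices σ hkc] at this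
      omega
    -- `w` is supported on `T` and still contains the missed symbol `x u`, so the isometry property
    -- makes `Θ w` large.
    obtain ⟨w, hw, hwres⟩ := exists_residual_eq Θ (firstIndices σ k) x e
    rw [hwres] at hres
    have hw0 : ∀ i ∉ T, w i = 0 := fun i hi => by rw [hw i fun h => hi (hsub h), hx i hi]
    have h1 := (hΘ.2.2 w ((l0norm_le_card hw0).trans (by omega))).1
    have h2 : Real.sqrt 2 * (c2 δ * lam) ≤ l2norm w := by
      refine (hmin u huT).le.trans ?_
      rw [← hw u huS]
      exact norm_apply_le_l2norm w u
    have h3 : l2norm (Θ.mulVec w) ≤ 2 * lam := by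
      have := l2norm_sub_le (Θ.mulVec w + e) e
      rw [add_sub_cancel_right] at this
      linarith
    have h4 : (Real.sqrt 2 * (c2 δ * lam)) ^ 2 ≤ l2norm w ^ 2 :=
      pow_le_pow_left₀ (by positivity) h2 2
    have h5 : l2norm (Θ.mulVec w) ^ 2 ≤ (2 * lam) ^ 2 := pow_le_pow_left₀ (l2norm_nonneg _) h3 2
    rw [mul_pow, Real.sq_sqrt (by norm_num), mul_pow] at h4
    have h6 : (4 : ℝ) ^ 2 * lam ^ 2 ≤ c2 δ ^ 2 * lam ^ 2 := by gcongr
    -- Hence `δ < 1/2`, and with `c₂ ≥ 4` one gets `16 λ² ≤ ‖Θ w‖² ≤ 4 λ²`, which is absurd.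
    have h7 : Real.sqrt 2 < 3 / 2 := by
      rw [Real.sqrt_lt' (by norm_num)]; norm_num
    have h8 : (1 / 2) * (2 * (4 ^ 2 * lam ^ 2)) ≤ (1 - δ) * l2norm w ^ 2 := by
      refine mul_le_mul (by linarith) (by linarith) (by positivity) (by linarith)
    have := sq_pos_of_pos hlam
    nlinarith
  · omega

end Detection

/-! ### Complex Gaussian laws: linear combinations, tails, exponential moments -/

section ComplexGaussian

theorem measurable_re_add_im :
    Measurable (fun q : ℝ × ℝ => (q.1 : ℂ) + (q.2 : ℂ) * Complex.I) := by fun_prop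

instance (p : NNReal) : IsProbabilityMeasure (complexGaussian p) :=
  Measure.isProbabilityMeasure_map measurable_re_add_im.aemeasurable

/-- Only `‖t‖` enters, so multiplication by `a` merely scales the variance by `‖a‖²`, and phases are
irrelevant. -/
theorem charFun_complexGaussian (p : NNReal) (t : ℂ) :
    charFun (complexGaussian p) t = Complex.exp (-(p * ‖t‖ ^ 2 / 4 : ℝ)) := by
  rw [charFun_apply, complexGaussian, integral_map measurable_re_add_im.aemeasurable
    (by fun_prop)]
  have h : ∀ q : ℝ × ℝ, Complex.exp ((inner ℝ ((q.1 : ℂ) + (q.2 : ℂ) * Complex.I) t : ℝ) *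
      Complex.I) = Complex.exp ((t.re * q.1 : ℝ) * Complex.I) *
        Complex.exp ((t.im * q.2 : ℝ) * Complex.I) := by
    intro q
    rw [← Complex.exp_add, ← add_mul, ← Complex.ofReal_add]
    congr 3
    simp [Complex.inner]
  simp_rw [h]
  rw [integral_prod_mul (fun a : ℝ => Complex.exp ((t.re * a : ℝ) * Complex.I))
    (fun b : ℝ => Complex.exp ((t.im * b : ℝ) * Complex.I))]
  have h1 := charFun_gaussianReal (μ := 0) (v := p / 2) t.re
  have h2 := charFun_gaussianReal (μ := 0) (v := p / 2) t.im
  rw [charFun_apply_real] at h1 h2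
  push_cast
  rw [h1, h2, ← Complex.exp_add]
  congr 1
  have h3 : (‖t‖ : ℂ) ^ 2 = t.re ^ 2 + t.im ^ 2 := by
    rw [← Complex.ofReal_pow, Complex.sq_norm, Complex.normSq_apply]
    push_cast
    ring
  rw [h3]
  push_cast
  ring

theorem charFun_map_mul (μ : Measure ℂ) (a t : ℂ) :
    charFun (μ.map (a * ·)) t = charFun μ (star a * t) := by
  rw [charFun_apply, charFun_apply, integral_map (by fun_prop) (by fun_prop)]
  refine integral_congr_ae (ae_of_all _ fun x => ?_)
  have h : inner ℝ (a * x) t = inner ℝ x (star a * t) := by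
    simp [Complex.inner]
    ring
  simp only [h]

/-- A linear combination of independent standard complex Gaussians is complex Gaussian. -/
theorem map_sum_mul_pi_complexGaussian {ι : Type*} [Fintype ι] (a : ι → ℂ) :
    (Measure.pi fun _ : ι => complexGaussian 1).map (fun n => ∑ c, a c * n c) =
      complexGaussian (∑ c, ‖a c‖₊ ^ 2) := by
  have hind : iIndepFun (fun (c : ι) (n : ι → ℂ) => a c * n c)
      (Measure.pi fun _ : ι => complexGaussian 1) :=
    iIndepFun_pi (μ := fun _ : ι => complexGaussian 1) (X := fun c z => a c * z) fun c =>
      (measurable_id.const_mul (a c)).aemeasurable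
  have hmeas : Measurable fun n : ι → ℂ => ∑ c, a c * n c := by fun_prop
  have := Measure.isProbabilityMeasure_map
    (μ := Measure.pi fun _ : ι => complexGaussian 1) hmeas.aemeasurable
  refine Measure.ext_of_charFun ?_
  rw [hind.charFun_map_fun_sum_eq_prod fun c =>
    ((measurable_pi_apply c).const_mul (a c)).aemeasurable]
  funext t
  rw [Finset.prod_apply, charFun_complexGaussian]
  have h : ∀ c, charFun ((Measure.pi fun _ : ι => complexGaussian 1).map fun n => a c * n c) t =
      Complex.exp (-(‖a c‖ ^ 2 * ‖t‖ ^ 2 / 4 : ℝ)) := by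
    intro c
    have e : (Measure.pi fun _ : ι => complexGaussian 1).map (fun n => a c * n c) =
        (complexGaussian 1).map (a c * ·) := by
      conv_rhs => rw [← (measurePreserving_eval (fun _ : ι => complexGaussian 1) c).map_eq]
      rw [Measure.map_map (by fun_prop) (by fun_prop)]
      rfl
    rw [e, charFun_map_mul, charFun_complexGaussian]
    congr 2
    simp [mul_pow]
  simp_rw [h]
  rw [← Complex.exp_sum]
  congr 1
  push_cast
  rw [Finset.sum_mul, Finset.sum_div, Finset.sum_neg_distrib]

theorem lintegral_Ioi_mul_exp {b t : ℝ} (hb : 0 < b) (ht : 0 ≤ t) :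
    ∫⁻ r in Set.Ioi t, ENNReal.ofReal (2 * b * r * Real.exp (-(b * r ^ 2))) =
      ENNReal.ofReal (Real.exp (-(b * t ^ 2))) := by
  have hd : ∀ r ∈ Set.Ici t, HasDerivAt (fun r => -Real.exp (-(b * r ^ 2)))
      (2 * b * r * Real.exp (-(b * r ^ 2))) r := by
    intro r _
    have := (((hasDerivAt_pow 2 r).const_mul b).neg.exp).neg
    convert! this using 1
    simp only [Pi.neg_apply]
    push_cast
    ring
  have hpos : ∀ r ∈ Set.Ioi t, 0 ≤ 2 * b * r * Real.exp (-(b * r ^ 2)) := by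
    intro r hr
    have : 0 < r := ht.trans_lt hr
    positivity
  have hlim : Filter.Tendsto (fun r => -Real.exp (-(b * r ^ 2))) Filter.atTop (nhds 0) := by
    rw [← neg_zero]
    exact (Real.tendsto_exp_neg_atTop_nhds_zero.comp
      ((Filter.tendsto_pow_atTop two_ne_zero).const_mul_atTop hb)).neg
  rw [← ofReal_integral_eq_lintegral_ofReal (integrableOn_Ioi_deriv_of_nonneg' hd hpos hlim)
    ((ae_restrict_iff' measurableSet_Ioi).2 (ae_of_all _ hpos)),
    integral_Ioi_of_hasDerivAt_of_nonneg' hd hpos hlim]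
  simp

/-- Polar coordinates: the angle contributes `2π` against the density `(πp)⁻¹ exp(-r²/p)`. Arbitrary
`f` serves both the tail and the exponential moment. -/
theorem lintegral_norm_complexGaussian {p : NNReal} (hp : p ≠ 0) {f : ℝ → ENNReal}
    (hf : Measurable f) :
    ∫⁻ z, f ‖z‖ ∂complexGaussian p =
      ∫⁻ r in Set.Ioi 0, ENNReal.ofReal (2 * (p : ℝ)⁻¹ * r * Real.exp (-((p : ℝ)⁻¹ * r ^ 2))) *
        f r := by
  have hp' : (0 : ℝ) < p := lt_of_le_of_ne p.2 (by exact_mod_cast hp.symm)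
  have hp2 : p / 2 ≠ 0 := by simpa using hp
  set g : ℝ → ENNReal := fun r =>
    ENNReal.ofReal ((Real.pi * p)⁻¹ * Real.exp (-((p : ℝ)⁻¹ * r ^ 2))) * f r with hg
  have hgm : Measurable g := by fun_prop
  have hpdf : ∀ q : ℝ × ℝ, gaussianPDF 0 (p / 2) q.1 * gaussianPDF 0 (p / 2) q.2 *
      f ‖(q.1 : ℂ) + (q.2 : ℂ) * Complex.I‖ = g ‖(q.1 : ℂ) + (q.2 : ℂ) * Complex.I‖ := by
    intro q
    simp only [hg]
    congr 1
    rw [gaussianPDF, gaussianPDF, ← ENNReal.ofReal_mul (gaussianPDFReal_nonneg _ _ _)]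
    congr 1
    simp only [gaussianPDFReal]
    have e : (2 * Real.pi * ((p / 2 : NNReal) : ℝ)) = Real.pi * p := by push_cast; ring
    have en : ‖(q.1 : ℂ) + (q.2 : ℂ) * Complex.I‖ ^ 2 = q.1 ^ 2 + q.2 ^ 2 := by
      rw [Complex.sq_norm, Complex.normSq_add_mul_I]
    rw [e, en, mul_mul_mul_comm, ← mul_inv, Real.mul_self_sqrt (by positivity), ← Real.exp_add]
    congr 2
    push_cast
    field_simp
    ring
  have hdens : Measurable fun q : ℝ × ℝ => gaussianPDF 0 (p / 2) q.1 * gaussianPDF 0 (p / 2) q.2 :=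
    ((measurable_gaussianPDF _ _).comp measurable_fst).mul
      ((measurable_gaussianPDF _ _).comp measurable_snd)
  rw [complexGaussian, lintegral_map (by fun_prop) measurable_re_add_im,
    gaussianReal_of_var_ne_zero _ hp2,
    prod_withDensity (measurable_gaussianPDF _ _) (measurable_gaussianPDF _ _),
    lintegral_withDensity_eq_lintegral_mul _ hdens (by fun_prop)]
  simp only [Pi.mul_apply, hpdf]
  rw [← Measure.volume_eq_prod, ← lintegral_comp_polarCoord_symm]
  have hn : ∀ q ∈ polarCoord.target, ENNReal.ofReal q.1 •
      g ‖((polarCoord.symm q).1 : ℂ) + ((polarCoord.symm q).2 : ℂ) * Complex.I‖ =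
      ENNReal.ofReal q.1 * g q.1 := by
    intro q hq
    have hq0 : 0 < q.1 := hq.1
    have en : ‖((polarCoord.symm q).1 : ℂ) + ((polarCoord.symm q).2 : ℂ) * Complex.I‖ = q.1 := by
      rw [← abs_of_pos hq0, ← Complex.norm_polarCoord_symm, Complex.polarCoord_symm_apply]
      congr 1
      simp [polarCoord]
      ring
    rw [en, smul_eq_mul]
  rw [setLIntegral_congr_fun polarCoord.open_target.measurableSet hn, polarCoord_target,
    Measure.volume_eq_prod, ← Measure.prod_restrict,
    lintegral_prod _ (by fun_prop)]
  simp only [lintegral_const, Measure.restrict_apply_univ, Real.volume_Ioo]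
  refine setLIntegral_congr_fun measurableSet_Ioi fun r hr => ?_
  have hr0 : 0 < r := hr
  simp only [hg]
  rw [← mul_assoc, mul_right_comm, ← ENNReal.ofReal_mul hr0.le,
    ← ENNReal.ofReal_mul (by positivity)]
  congr 2
  field_simp
  ring

theorem complexGaussian_norm_le {p : NNReal} (hp : 0 < p) {t : ℝ} (ht : 0 ≤ t) :
    (complexGaussian p).real {z | ‖z‖ ≤ t} = 1 - Real.exp (-(t ^ 2 / p)) := by
  have hm : MeasurableSet {z : ℂ | t < ‖z‖} := measurableSet_lt (by fun_prop) (by fun_prop)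
  have h1 : complexGaussian p {z | t < ‖z‖} = ENNReal.ofReal (Real.exp (-(t ^ 2 / p))) := by
    have e : complexGaussian p {z | t < ‖z‖} =
        ∫⁻ z, (Set.Ioi t).indicator 1 ‖z‖ ∂complexGaussian p := by
      rw [← lintegral_indicator_one hm]
      rfl
    rw [e, lintegral_norm_complexGaussian hp.ne' (measurable_one.indicator measurableSet_Ioi)]
    have e2 : ∀ r : ℝ, ENNReal.ofReal (2 * (p : ℝ)⁻¹ * r * Real.exp (-((p : ℝ)⁻¹ * r ^ 2))) *
        (Set.Ioi t).indicator 1 r = (Set.Ioi t).indicator (fun r =>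
          ENNReal.ofReal (2 * (p : ℝ)⁻¹ * r * Real.exp (-((p : ℝ)⁻¹ * r ^ 2)))) r := by
      intro r
      by_cases hr : r ∈ Set.Ioi t <;> simp [hr]
    simp_rw [e2]
    rw [setLIntegral_indicator measurableSet_Ioi,
      Set.inter_eq_left.2 (Set.Ioi_subset_Ioi ht),
      lintegral_Ioi_mul_exp (by positivity) ht, div_eq_inv_mul]
  have h2 : {z : ℂ | ‖z‖ ≤ t} = {z : ℂ | t < ‖z‖}ᶜ := by ext z; simp
  rw [h2, probReal_compl_eq_one_sub hm, measureReal_def, h1,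
    ENNReal.toReal_ofReal (Real.exp_pos _).le]

/-- The moment of the exponential variable `‖z‖²` is `1/(1 - sp)`, evaluated at `sp = 1/2`. -/
theorem lintegral_exp_norm_sq_complexGaussian {p : NNReal} {s : ℝ} (hs : 0 < s)
    (hsp : s * p = 1 / 2) :
    ∫⁻ z, ENNReal.ofReal (Real.exp (s * ‖z‖ ^ 2)) ∂complexGaussian p = 2 := by
  have hp : p ≠ 0 := by rintro rfl; norm_num at hsp
  have hpi : (p : ℝ)⁻¹ = 2 * s := by
    refine inv_eq_of_mul_eq_one_left ?_
    linarith
  rw [lintegral_norm_complexGaussian (f := fun r => ENNReal.ofReal (Real.exp (s * r ^ 2))) hp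
    (by fun_prop)]
  have e : ∀ r ∈ Set.Ioi (0 : ℝ),
      ENNReal.ofReal (2 * (p : ℝ)⁻¹ * r * Real.exp (-((p : ℝ)⁻¹ * r ^ 2))) *
        ENNReal.ofReal (Real.exp (s * r ^ 2)) =
      2 * ENNReal.ofReal (2 * s * r * Real.exp (-(s * r ^ 2))) := by
    intro r hr
    have hr0 : (0 : ℝ) < r := hr
    rw [hpi, ← ENNReal.ofReal_mul (by positivity), mul_assoc _ (Real.exp _), ← Real.exp_add,
      show (2 : ENNReal) = ENNReal.ofReal 2 by simp, ← ENNReal.ofReal_mul (by norm_num)]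
    congr 1
    rw [show -(2 * s * r ^ 2) + s * r ^ 2 = -(s * r ^ 2) by ring]
    ring
  rw [setLIntegral_congr_fun measurableSet_Ioi e, lintegral_const_mul _ (by fun_prop),
    lintegral_Ioi_mul_exp hs le_rfl]
  simp

end ComplexGaussian

/-! ### Chernoff bound for the compressed noise -/

theorem map_uncurry_pi_pi {ι ι' α : Type*} [Fintype ι] [Fintype ι'] [MeasurableSpace α]
    (μ : Measure α) [SigmaFinite μ] :
    (Measure.pi fun _ : ι => Measure.pi fun _ : ι' => μ).map
      (fun n (p : ι × ι') => n p.1 p.2) = Measure.pi fun _ => μ := by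
  symm
  refine Measure.pi_eq fun s hs => ?_
  rw [Measure.map_apply (by fun_prop) (MeasurableSet.univ_pi hs)]
  have : (fun (n : ι → ι' → α) (p : ι × ι') => n p.1 p.2) ⁻¹' Set.univ.pi s =
      Set.univ.pi fun i => Set.univ.pi fun c => s (i, c) := by
    ext n
    simp [Set.mem_pi, Prod.forall]
  rw [this, Measure.pi_pi]
  simp_rw [Measure.pi_pi]
  rw [Fintype.prod_prod_type]

theorem hasLaw_pi_pi {Ω ι ι' α : Type*} [MeasurableSpace Ω] {P : Measure Ω} [Fintype ι]
    [Fintype ι'] [MeasurableSpace α] {μ : Measure α} [SigmaFinite μ] {n : Ω → ι → ι' → α}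
    (hlaw : ∀ i c, HasLaw (fun ω => n ω i c) μ P)
    (hind : iIndepFun (fun (p : ι × ι') ω => n ω p.1 p.2) P) :
    HasLaw n (Measure.pi fun _ => Measure.pi fun _ => μ) P where
  aemeasurable := aemeasurable_pi_iff.2 fun i => aemeasurable_pi_iff.2 fun c =>
    (hlaw i c).aemeasurable
  map_eq := by
    have h := hind.hasLaw_pi (μ := fun _ => μ) fun p : ι × ι' => hlaw p.1 p.2
    have hcurry : Measurable fun (m : ι × ι' → α) (i : ι) (c : ι') => m (i, c) := by fun_prop
    have e : n = (fun (m : ι × ι' → α) (i : ι) (c : ι') => m (i, c)) ∘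
        fun ω (p : ι × ι') => n ω p.1 p.2 := rfl
    rw [e, ← AEMeasurable.map_map_of_aemeasurable hcurry.aemeasurable h.aemeasurable, h.map_eq,
      ← map_uncurry_pi_pi, Measure.map_map hcurry (by fun_prop)]
    exact Measure.map_id

section Noise

variable {M Nc R : ℕ}

/-- The compressed noise, with blocks `A_i n_i`. -/
def noiseVec (A : Fin M → Matrix (Fin R) (Fin Nc) ℂ) (n : Fin M → Fin Nc → ℂ) :
    Fin M × Fin R → ℂ := fun q => (A q.1).mulVec (n q.1) q.2

theorem norm_compression (θ : Fin M → Fin R → Fin Nc → ℝ) (i : Fin M) (r : Fin R) (c : Fin Nc) :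
    ‖compression θ i r c‖ ^ 2 = 1 / (M * R) := by
  rw [compression, Matrix.of_apply, norm_mul, Complex.norm_exp_ofReal_mul_I, mul_one,
    Complex.norm_real, Real.norm_of_nonneg (Real.sqrt_nonneg _), Real.sq_sqrt (by positivity)]

theorem lintegral_exp_row (hM : 0 < M) (hNc : 0 < Nc) (hR : 0 < R)
    (θ : Fin M → Fin R → Fin Nc → ℝ) (i : Fin M) (r : Fin R) :
    ∫⁻ n, ENNReal.ofReal (Real.exp (M / (2 * Nc) * R * ‖(compression θ i).mulVec n r‖ ^ 2))
      ∂(Measure.pi fun _ : Fin Nc => complexGaussian 1) = 2 := by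
  have hm : Measurable fun n : Fin Nc → ℂ => ∑ c, compression θ i r c * n c := by fun_prop
  have h := lintegral_exp_norm_sq_complexGaussian (p := ∑ c, ‖compression θ i r c‖₊ ^ 2)
    (s := M / (2 * Nc) * R) (by positivity) (by
      push_cast
      simp_rw [norm_compression]
      simp only [Finset.sum_const, Finset.card_univ, Fintype.card_fin, nsmul_eq_mul]
      field_simp)
  rw [← map_sum_mul_pi_complexGaussian, lintegral_map (by fun_prop) hm] at h
  exact h

/-- For fixed phases the rows of `A_i n_i` share the same noise. Convexity of `exp` replaces the sum
over rows by an average of single-row exponentials, each of expectation `2`. -/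
theorem lintegral_exp_block (hM : 0 < M) (hNc : 0 < Nc) (hR : 0 < R)
    (θ : Fin M → Fin R → Fin Nc → ℝ) (i : Fin M) :
    ∫⁻ n, ENNReal.ofReal (Real.exp (M / (2 * Nc) * ∑ r, ‖(compression θ i).mulVec n r‖ ^ 2))
      ∂(Measure.pi fun _ : Fin Nc => complexGaussian 1) ≤ 2 := by
  have hR' : (R : ℝ) ≠ 0 := by positivity
  have hm : ∀ r, Measurable fun n : Fin Nc → ℂ => (compression θ i).mulVec n r := by
    intro r
    simp only [Matrix.mulVec, dotProduct]
    fun_prop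
  have hjensen : ∀ n : Fin Nc → ℂ,
      ENNReal.ofReal (Real.exp (M / (2 * Nc) * ∑ r, ‖(compression θ i).mulVec n r‖ ^ 2)) ≤
      ∑ r, ENNReal.ofReal (1 / R) *
        ENNReal.ofReal (Real.exp (M / (2 * Nc) * R * ‖(compression θ i).mulVec n r‖ ^ 2)) := by
    intro n
    have h := convexOn_exp.map_sum_le (t := Finset.univ) (w := fun _ : Fin R => (1 / R : ℝ))
      (p := fun r => M / (2 * Nc) * R * ‖(compression θ i).mulVec n r‖ ^ 2)
      (fun _ _ => by positivity) (by simp [hR']) (fun _ _ => Set.mem_univ _)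
    simp only [smul_eq_mul] at h
    simp_rw [← ENNReal.ofReal_mul (show (0 : ℝ) ≤ 1 / R by positivity)]
    rw [← ENNReal.ofReal_sum_of_nonneg fun _ _ => by positivity]
    refine ENNReal.ofReal_le_ofReal (le_of_eq_of_le ?_ h)
    congr 1
    rw [Finset.mul_sum]
    refine Finset.sum_congr rfl fun r _ => ?_
    field_simp
  refine (lintegral_mono hjensen).trans ?_
  rw [lintegral_finsetSum _ fun r _ => by have := hm r; fun_prop]
  have h : ∀ r ∈ Finset.univ, ∫⁻ n, ENNReal.ofReal (1 / R) *
      ENNReal.ofReal (Real.exp (M / (2 * Nc) * R * ‖(compression θ i).mulVec n r‖ ^ 2))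
        ∂(Measure.pi fun _ : Fin Nc => complexGaussian 1) = ENNReal.ofReal (1 / R) * 2 := by
    intro r _
    rw [lintegral_const_mul _ (by have := hm r; fun_prop), lintegral_exp_row hM hNc hR]
  rw [Finset.sum_congr rfl h, Finset.sum_const, Finset.card_univ, Fintype.card_fin, nsmul_eq_mul,
    ← mul_assoc, ← ENNReal.ofReal_natCast, ← ENNReal.ofReal_mul (by positivity),
    mul_one_div_cancel hR']
  simp

theorem chernoff_exponent_le {lam : ℝ} (hNc : 0 < Nc) (hlam : Real.sqrt (2 * Nc) ≤ lam) :
    2 ^ M * Real.exp (-(M / (2 * Nc) * lam ^ 2)) ≤ Real.exp (-(c1 lam Nc) * M) := by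
  have hN : (0 : ℝ) < Nc := by exact_mod_cast hNc
  have h2 : 2 * (Nc : ℝ) ≤ lam ^ 2 := by
    rw [← Real.sq_sqrt (show (0 : ℝ) ≤ 2 * Nc by positivity)]
    exact pow_le_pow_left₀ (Real.sqrt_nonneg _) hlam 2
  have e2 : (2 : ℝ) ^ M = Real.exp (M * Real.log 2) := by
    rw [Real.exp_nat_mul, Real.exp_log (by norm_num)]
  rw [e2, ← Real.exp_add, Real.exp_le_exp, c1]
  -- The inequality needed is `log 2 ≤ (λ² + Nc)/(4 Nc)`, whose right side is at least `3/4` when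
  -- `λ² ≥ 2 Nc`.
  have hlog : Real.log 2 < 3 / 4 := Real.log_two_lt_d9.trans (by norm_num)
  have hlog2 : Real.log 2 ≤ lam ^ 2 / (2 * Nc) - (lam ^ 2 - Nc) / (4 * Nc) := by
    have e : lam ^ 2 / (2 * Nc) - (lam ^ 2 - Nc) / (4 * Nc) = (lam ^ 2 + Nc) / (4 * Nc) := by
      field_simp
      ring
    rw [e]
    refine hlog.le.trans ?_
    rw [le_div_iff₀ (by positivity)]
    linarith
  have := mul_le_mul_of_nonneg_left hlog2 (Nat.cast_nonneg (α := ℝ) M)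
  have e3 : (M : ℝ) / (2 * Nc) * lam ^ 2 = M * (lam ^ 2 / (2 * Nc)) := by ring
  rw [e3]
  linarith

/-- Chernoff bound for the compressed noise, for given compression matrices. -/
theorem measure_lt_l2norm_noiseVec_le (hM : 0 < M) (hNc : 0 < Nc) (hR : 0 < R)
    (θ : Fin M → Fin R → Fin Nc → ℝ) {lam : ℝ} (hlam : Real.sqrt (2 * Nc) ≤ lam) :
    (Measure.pi fun _ : Fin M => Measure.pi fun _ : Fin Nc => complexGaussian 1)
      {n | lam < l2norm (noiseVec (compression θ) n)} ≤
      ENNReal.ofReal (Real.exp (-(c1 lam Nc) * M)) := by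
  set ν := Measure.pi fun _ : Fin M => Measure.pi fun _ : Fin Nc => complexGaussian 1 with hν
  set f : Fin M → (Fin Nc → ℂ) → ENNReal := fun i v =>
    ENNReal.ofReal (Real.exp (M / (2 * Nc) * ∑ r, ‖(compression θ i).mulVec v r‖ ^ 2)) with hf
  have hfm : ∀ i, Measurable (f i) := by
    intro i
    simp only [hf, Matrix.mulVec, dotProduct]
    fun_prop
  have hlam0 : 0 ≤ lam := (Real.sqrt_nonneg _).trans hlam
  have hprod : ∀ n : Fin M → Fin Nc → ℂ, ∏ i, f i (n i) =
      ENNReal.ofReal (Real.exp (M / (2 * Nc) * l2norm (noiseVec (compression θ) n) ^ 2)) := by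
    intro n
    simp only [hf]
    rw [← ENNReal.ofReal_prod_of_nonneg fun _ _ => (Real.exp_pos _).le, ← Real.exp_sum,
      ← Finset.mul_sum, l2norm_sq, Fintype.sum_prod_type]
    rfl
  have hind : iIndepFun (fun i (n : Fin M → Fin Nc → ℂ) => f i (n i)) ν :=
    iIndepFun_pi (μ := fun _ : Fin M => Measure.pi fun _ : Fin Nc => complexGaussian 1) (X := f)
      fun i => (hfm i).aemeasurable
  have hexp : ∫⁻ n, ∏ i, f i (n i) ∂ν ≤ 2 ^ M := by
    rw [lintegral_prod_eq_prod_lintegral_of_indepFun Finset.univ _ hind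
      fun i => (hfm i).comp (measurable_pi_apply i)]
    calc _ ≤ ∏ _i : Fin M, (2 : ENNReal) := by
          refine Finset.prod_le_prod' fun i _ => ?_
          rw [← lintegral_map (hfm i) (measurable_pi_apply i),
            (measurePreserving_eval
              (fun _ : Fin M => Measure.pi fun _ : Fin Nc => complexGaussian 1) i).map_eq]
          exact lintegral_exp_block hM hNc hR θ i
      _ = 2 ^ M := by simp
  have hset : {n | lam < l2norm (noiseVec (compression θ) n)} ⊆
      {n | ENNReal.ofReal (Real.exp (M / (2 * Nc) * lam ^ 2)) ≤ ∏ i, f i (n i)} := by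
    intro n hn
    rw [Set.mem_ofPred_eq] at hn ⊢
    rw [hprod]
    refine ENNReal.ofReal_le_ofReal (Real.exp_le_exp.2 ?_)
    gcongr
  have hmk := mul_meas_ge_le_lintegral₀ (μ := ν) (f := fun n => ∏ i, f i (n i))
    (Finset.measurable_fun_prod _ fun i _ => (hfm i).comp (measurable_pi_apply i)).aemeasurable
    (ENNReal.ofReal (Real.exp (M / (2 * Nc) * lam ^ 2)))
  set E := ENNReal.ofReal (Real.exp (M / (2 * Nc) * lam ^ 2)) with hE
  have hinv : ENNReal.ofReal (Real.exp (-(M / (2 * Nc) * lam ^ 2))) * E = 1 := by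
    rw [hE, ← ENNReal.ofReal_mul (Real.exp_pos _).le, ← Real.exp_add]
    simp
  calc _ ≤ ν {n | E ≤ ∏ i, f i (n i)} := measure_mono hset
    _ = ENNReal.ofReal (Real.exp (-(M / (2 * Nc) * lam ^ 2))) *
        (E * ν {n | E ≤ ∏ i, f i (n i)}) := by rw [← mul_assoc, hinv, one_mul]
    _ ≤ ENNReal.ofReal (Real.exp (-(M / (2 * Nc) * lam ^ 2))) * 2 ^ M := by
        gcongr
        exact hmk.trans hexp
    _ = ENNReal.ofReal (2 ^ M * Real.exp (-(M / (2 * Nc) * lam ^ 2))) := by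
        rw [mul_comm, ENNReal.ofReal_mul (by positivity), ENNReal.ofReal_pow (by norm_num)]
        simp
    _ ≤ _ := ENNReal.ofReal_le_ofReal (chernoff_exponent_le hNc hlam)

end Noise

theorem continuous_l2norm {ι : Type*} [Fintype ι] : Continuous (l2norm : (ι → ℂ) → ℝ) :=
  (PiLp.continuous_toLp 2 _).norm

/-! ### Measurability and independence in the uplink model -/

section System

variable {M K Nc R : ℕ}

theorem measMatrix_apply (A : Fin M → Matrix (Fin R) (Fin Nc) ℂ) (H : Fin M → UE K Nc → ℂ)
    (q : Fin M × Fin R) (u : UE K Nc) : measMatrix A H q u = A q.1 q.2 u.1 * H q.1 u := by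
  simp [measMatrix, channelMatrix, Matrix.mul_apply]

theorem compressed_eq (A : Fin M → Matrix (Fin R) (Fin Nc) ℂ) (H : Fin M → UE K Nc → ℂ)
    (x : UE K Nc → ℂ) (n : Fin M → Fin Nc → ℂ) :
    compressed A H x n = (measMatrix A H).mulVec x + noiseVec A n := by
  funext q
  have h : (measMatrix A H).mulVec x q = ((A q.1 * channelMatrix H q.1).mulVec x) q.2 := rfl
  rw [Pi.add_apply, h, compressed, Matrix.mulVec_add, Matrix.mulVec_mulVec]
  rfl

/-- Closedness yields measurability although the condition ranges over uncountably many `v`. -/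
theorem isClosed_setOf_RIP (k : ℕ) (δ : ℝ) :
    IsClosed {y : (Fin M → UE K Nc → ℝ) × (Fin M → UE K Nc → ℂ) × (Fin M → Fin R → Fin Nc → ℝ) |
      RIP (measMatrix (compression y.2.2) (channel y.1 y.2.1)) k δ} := by
  have hcont : ∀ v : UE K Nc → ℂ, Continuous fun y : (Fin M → UE K Nc → ℝ) ×
      (Fin M → UE K Nc → ℂ) × (Fin M → Fin R → Fin Nc → ℝ) =>
      l2norm ((measMatrix (compression y.2.2) (channel y.1 y.2.1)).mulVec v) := by
    intro v
    refine continuous_l2norm.comp (continuous_pi fun q => ?_)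
    simp only [Matrix.mulVec, dotProduct, measMatrix_apply, compression, channel, Matrix.of_apply]
    fun_prop
  simp only [RIP, Set.ofPred_and, Set.ofPred_forall]
  exact isClosed_const.inter (isClosed_const.inter (isClosed_iInter fun v => isClosed_iInter
    fun _ => (isClosed_le continuous_const ((hcont v).pow 2)).inter
      (isClosed_le ((hcont v).pow 2) continuous_const)))

theorem continuous_l2norm_noiseVec :
    Continuous fun p : (Fin M → Fin Nc → ℂ) × (Fin M → Fin R → Fin Nc → ℝ) =>
      l2norm (noiseVec (compression p.2) p.1) := by
  refine continuous_l2norm.comp (continuous_pi fun q => ?_)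
  simp only [noiseVec, Matrix.mulVec, dotProduct, compression, Matrix.of_apply]
  fun_prop

end System

namespace UplinkModel

variable {Ω : Type*} [MeasurableSpace Ω] {μ : Measure Ω} {M K Nc R : ℕ}
  {T : Finset (UE K Nc)} {P : UE K Nc → NNReal} {gbar : ℝ}
  {g : Ω → Fin M → UE K Nc → ℝ} {h : Ω → Fin M → UE K Nc → ℂ}
  {θ : Ω → Fin M → Fin R → Fin Nc → ℝ} {x : Ω → UE K Nc → ℂ} {n : Ω → Fin M → Fin Nc → ℂ}

theorem aemeasurable_prod (hmodel : UplinkModel μ T P gbar g h θ x n) :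
    AEMeasurable (fun ω => (g ω, h ω, θ ω)) μ := by
  have hh : AEMeasurable h μ := aemeasurable_pi_iff.2 fun i => aemeasurable_pi_iff.2 fun u =>
    (hmodel.h_law i u).aemeasurable
  have hθ : AEMeasurable θ μ := aemeasurable_pi_iff.2 fun i => aemeasurable_pi_iff.2 fun r =>
    aemeasurable_pi_iff.2 fun c => (hmodel.θ_law i r c).aemeasurable
  exact hmodel.g_measurable.aemeasurable.prodMk (hh.prodMk hθ)

/-- Given the measurement matrix, large noise is exponentially unlikely. -/
theorem measure_RIP_inter_noise_le [IsProbabilityMeasure μ]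
    (hmodel : UplinkModel μ T P gbar g h θ x n) (hT : T.Nonempty) {lam δ : ℝ}
    (hlam : Real.sqrt (2 * Nc) ≤ lam) :
    μ ({ω | RIP (randTheta g h θ ω) (2 * T.card) δ} ∩
        {ω | lam < l2norm (noiseVec (compression (θ ω)) (n ω))}) ≤
      ENNReal.ofReal (Real.exp (-(c1 lam Nc) * M)) *
        μ {ω | RIP (randTheta g h θ ω) (2 * T.card) δ} := by
  have hY := hmodel.aemeasurable_prod
  have hn := hasLaw_pi_pi hmodel.n_law hmodel.n_indep
  set E := {y : (Fin M → UE K Nc → ℝ) × (Fin M → UE K Nc → ℂ) × (Fin M → Fin R → Fin Nc → ℝ) |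
    RIP (measMatrix (compression y.2.2) (channel y.1 y.2.1)) (2 * T.card) δ} with hE
  have hEm : MeasurableSet E := (isClosed_setOf_RIP _ _).measurableSet
  set D : Set ((Fin M → Fin Nc → ℂ) × ((Fin M → UE K Nc → ℝ) × (Fin M → UE K Nc → ℂ) ×
      (Fin M → Fin R → Fin Nc → ℝ))) :=
    {p | lam < l2norm (noiseVec (compression p.2.2.2) p.1)} with hD
  have hDm : MeasurableSet D := by
    have h0 : MeasurableSet {p : (Fin M → Fin Nc → ℂ) × (Fin M → Fin R → Fin Nc → ℝ) |
        lam < l2norm (noiseVec (compression p.2) p.1)} :=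
      (isOpen_lt continuous_const continuous_l2norm_noiseVec).measurableSet
    exact h0.preimage (f := fun p : (Fin M → Fin Nc → ℂ) × ((Fin M → UE K Nc → ℝ) ×
      (Fin M → UE K Nc → ℂ) × (Fin M → Fin R → Fin Nc → ℝ)) => (p.1, p.2.2.2)) (by fun_prop)
  have hED : MeasurableSet ((Prod.snd ⁻¹' E) ∩ D) := (measurable_snd hEm).inter hDm
  have hlaw := hmodel.indep_n.map_prod_eq_prod_map_map hn.aemeasurable hY
  have h1 : μ ({ω | RIP (randTheta g h θ ω) (2 * T.card) δ} ∩
      {ω | lam < l2norm (noiseVec (compression (θ ω)) (n ω))}) =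
      (μ.map fun ω => (n ω, (g ω, h ω, θ ω))) ((Prod.snd ⁻¹' E) ∩ D) := by
    rw [Measure.map_apply_of_aemeasurable (hn.aemeasurable.prodMk hY) hED]
    rfl
  have h2 : μ {ω | RIP (randTheta g h θ ω) (2 * T.card) δ} =
      (μ.map fun ω => (g ω, h ω, θ ω)) E := by
    rw [Measure.map_apply_of_aemeasurable hY hEm]
    rfl
  have := Measure.isProbabilityMeasure_map hY
  have := Measure.isProbabilityMeasure_map hn.aemeasurable
  -- Fubini with `(g, h, θ)` frozen: the slice is empty when the isometry property fails, and
  -- otherwise obeys the Chernoff bound uniformly in `θ`.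
  rw [h1, h2, hlaw, Measure.prod_apply_symm hED, ← lintegral_indicator_const hEm]
  refine lintegral_mono fun y => ?_
  by_cases hy : y ∈ E
  · rw [Set.indicator_of_mem hy, hn.map_eq]
    have hcard := card_le_card_of_RIP hy (T := T) (by omega)
    rw [Fintype.card_prod, Fintype.card_fin, Fintype.card_fin] at hcard
    have hMR : 0 < M * R := hT.card_pos.trans_le hcard
    obtain ⟨u, _⟩ := hT
    refine (measure_mono ?_).trans (measure_lt_l2norm_noiseVec_le (Nat.pos_of_mul_pos_right hMR)
      u.1.pos (Nat.pos_of_mul_pos_left hMR) y.2.2 hlam)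
    exact fun m hm => hm.2
  · rw [Set.indicator_of_notMem hy]
    refine (measure_mono_null (t := ∅) ?_ measure_empty).le
    exact fun m hm => hy hm.1

/-- The symbols are independent of the measurement matrix, and small symbols are unlikely. -/
theorem measure_RIP_inter_symbol_le [IsProbabilityMeasure μ]
    (hmodel : UplinkModel μ T P gbar g h θ x n) (hT : T.Nonempty) {δ t : ℝ} (ht : 0 ≤ t) (k : ℕ) :
    μ.real ({ω | RIP (randTheta g h θ ω) k δ} ∩ {ω | ∃ u ∈ T, ‖x ω u‖ ≤ t}) ≤
      T.card * (1 - Real.exp (-(t ^ 2 / ((T.inf' hT P : NNReal) : ℝ)))) *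
        μ.real {ω | RIP (randTheta g h θ ω) k δ} := by
  have hset : {y : UE K Nc → ℂ | ∃ u ∈ T, ‖y u‖ ≤ t} = ⋃ u ∈ T, {y | ‖y u‖ ≤ t} := by
    ext y
    simp
  have hXm : MeasurableSet {y : UE K Nc → ℂ | ∃ u ∈ T, ‖y u‖ ≤ t} := by
    rw [hset]
    exact Finset.measurableSet_biUnion _ fun u _ =>
      measurableSet_le (by fun_prop) (by fun_prop)
  have hEm : MeasurableSet {y : (Fin M → UE K Nc → ℝ) × (Fin M → UE K Nc → ℂ) ×
      (Fin M → Fin R → Fin Nc → ℝ) × (Fin M → Fin Nc → ℂ) |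
      RIP (measMatrix (compression y.2.2.1) (channel y.1 y.2.1)) k δ} :=
    (isClosed_setOf_RIP (M := M) (K := K) (Nc := Nc) (R := R) k δ).measurableSet.preimage
      (f := fun y : (Fin M → UE K Nc → ℝ) × (Fin M → UE K Nc → ℂ) ×
        (Fin M → Fin R → Fin Nc → ℝ) × (Fin M → Fin Nc → ℂ) => (y.1, y.2.1, y.2.2.1))
      (by fun_prop)
  have hind := hmodel.indep_x.measure_inter_preimage_eq_mul _ _ hXm hEm
  have hprod : μ.real ({ω | RIP (randTheta g h θ ω) k δ} ∩ {ω | ∃ u ∈ T, ‖x ω u‖ ≤ t}) =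
      μ.real {ω | ∃ u ∈ T, ‖x ω u‖ ≤ t} * μ.real {ω | RIP (randTheta g h θ ω) k δ} := by
    rw [Set.inter_comm, measureReal_def, measureReal_def, measureReal_def, ← ENNReal.toReal_mul]
    exact congrArg ENNReal.toReal hind
  rw [hprod]
  gcongr
  have hun : {ω | ∃ u ∈ T, ‖x ω u‖ ≤ t} = ⋃ u ∈ T, {ω | ‖x ω u‖ ≤ t} := by
    ext ω
    simp
  rw [hun, ← nsmul_eq_mul, ← Finset.sum_const]
  refine (measureReal_biUnion_finset_le _ _).trans (Finset.sum_le_sum fun u hu => ?_)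
  have hlaw := hmodel.x_law u hu
  have hm : MeasurableSet {z : ℂ | ‖z‖ ≤ t} := measurableSet_le (by fun_prop) (by fun_prop)
  have h1 : μ.real {ω | ‖x ω u‖ ≤ t} = 1 - Real.exp (-(t ^ 2 / P u)) := by
    rw [← complexGaussian_norm_le (hmodel.P_pos u hu) ht, ← hlaw.map_eq, measureReal_def,
      measureReal_def, Measure.map_apply_of_aemeasurable hlaw.aemeasurable hm]
    rfl
  rw [h1]
  have hmin : 0 < T.inf' hT P := (Finset.lt_inf'_iff hT).2 hmodel.P_pos
  have hle : T.inf' hT P ≤ P u := Finset.inf'_le P hu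
  gcongr

end UplinkModel

end CRAN

/-! ### Probability of exact detection -/

open CRAN
theorem theorem2 {Ω : Type*} [MeasurableSpace Ω] (μ : Measure Ω) [IsProbabilityMeasure μ]
    {M K Nc R : ℕ} (T : Finset (UE K Nc)) (hT : T.Nonempty) (P : UE K Nc → NNReal) (gbar : ℝ)
    (g : Ω → Fin M → UE K Nc → ℝ) (h : Ω → Fin M → UE K Nc → ℂ)
    (θ : Ω → Fin M → Fin R → Fin Nc → ℝ)
    (x : Ω → UE K Nc → ℂ) (n : Ω → Fin M → Fin Nc → ℂ)
    (hmodel : UplinkModel μ T P gbar g h θ x n)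
    (lam : ℝ) (hlam : Real.sqrt (2 * Nc) ≤ lam)
    (δ : ℝ) (hδ : δ < Real.sqrt 2 - 1)
    (That : Ω → Finset (UE K Nc))
    (hThat : ∀ᵐ ω ∂μ, (bpFeasible (randTheta g h θ ω) (randZ g h θ x n ω) lam).Nonempty →
      IsDetectedSet (randTheta g h θ ω) (randZ g h θ x n ω) lam (That ω)) :
    μ.real {ω | That ω = T} ≥
      μ.real {ω | RIP (randTheta g h θ ω) (2 * T.card) δ} *
        (1 - Real.exp (-(c1 lam Nc) * M) -
          T.card * (1 - Real.exp (-(2 * (c2 δ * lam) ^ 2 / ((T.inf' hT P : NNReal) : ℝ))))) := by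
  have hNc : 0 < Nc := hT.choose.1.pos
  have hlam0 : 0 < lam := lt_of_lt_of_le (Real.sqrt_pos.2 (by positivity)) hlam
  have hc2 : 0 ≤ c2 δ := by
    have := one_sub_mul_pos hδ
    rw [c2]
    positivity
  set E := {ω | RIP (randTheta g h θ ω) (2 * T.card) δ} with hE
  set N := {ω | lam < l2norm (noiseVec (compression (θ ω)) (n ω))} with hN
  set X := {ω | ∃ u ∈ T, ‖x ω u‖ ≤ Real.sqrt 2 * (c2 δ * lam)} with hX
  have hcover : E ≤ᵐ[μ] ({ω | That ω = T} ∪ E ∩ N ∪ E ∩ X : Set Ω) := by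
    filter_upwards [hThat, hmodel.x_zero] with ω hω hx hEω
    by_cases hNω : ω ∈ N
    · exact Or.inl (Or.inr ⟨hEω, hNω⟩)
    by_cases hXω : ω ∈ X
    · exact Or.inr ⟨hEω, hXω⟩
    refine Or.inl (Or.inl ?_)
    have hz : randZ g h θ x n ω =
        (randTheta g h θ ω).mulVec (x ω) + noiseVec (compression (θ ω)) (n ω) :=
      compressed_eq _ _ _ _
    have he : l2norm (noiseVec (compression (θ ω)) (n ω)) ≤ lam := not_lt.1 hNω
    have hmin : ∀ u ∈ T, Real.sqrt 2 * (c2 δ * lam) < ‖x ω u‖ := fun u hu =>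
      not_le.1 fun hle => hXω ⟨u, hu, hle⟩
    rw [hz] at hω
    refine IsDetectedSet.eq_of_RIP hT hEω hδ hlam0 hx hmin he (hω ⟨x ω, ?_⟩)
    change l2norm (_ - (_ + _)) ≤ lam
    rwa [sub_add_cancel_left, l2norm_neg]
  -- Monotonicity and subadditivity suffice, so `{That = T}` need not be measurable.
  have hle : μ.real E ≤ μ.real {ω | That ω = T} + μ.real (E ∩ N) + μ.real (E ∩ X) := by
    have h1 : μ.real E ≤ μ.real ({ω | That ω = T} ∪ E ∩ N ∪ E ∩ X) :=
      ENNReal.toReal_mono (measure_ne_top _ _) (measure_mono_ae hcover)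
    linarith [measureReal_union_le (μ := μ) ({ω | That ω = T} ∪ E ∩ N) (E ∩ X),
      measureReal_union_le (μ := μ) {ω | That ω = T} (E ∩ N)]
  have hnoise : μ.real (E ∩ N) ≤ Real.exp (-(c1 lam Nc) * M) * μ.real E := by
    rw [measureReal_def, measureReal_def, ← ENNReal.toReal_ofReal (Real.exp_pos _).le,
      ← ENNReal.toReal_mul]
    exact ENNReal.toReal_mono (ENNReal.mul_ne_top ENNReal.ofReal_ne_top (measure_ne_top _ _))
      (hmodel.measure_RIP_inter_noise_le hT hlam)
  have hsymbol := hmodel.measure_RIP_inter_symbol_le hT (δ := δ)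
    (t := Real.sqrt 2 * (c2 δ * lam)) (by positivity) (2 * T.card)
  rw [mul_pow, Real.sq_sqrt (by norm_num)] at hsymbol
  linarith
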